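/- Tropical arithmetic is $(\min,+)$. Identify symmetric real $n\times n$ matrices with points of $\mathbb R^{\binom{n+1}{2}}$. A \emph{symmetric $3\times 3$ tropical minor} is the tropicalization of a $3\times3$ minor (any three rows, any three columns) of the matrix of variables $x_{ij}=x_{ji}$, regarded as a polynomial in the $\binom{n+1}{2}$ variables $x_{ij}$, $i\le j$, over a field of characteristic $0$ with trivial valuation on the coefficients. A symmetric matrix has \emph{symmetric tropical rank two} (meaning at most two) if in each symmetric $3\times3$ tropical minor the minimum is attained by at least two monomials. The \emph{minor fan} $\Sigma_{\min}$ on the set of these matrices consists of the cones $D_A$, for $A$ of symmetric tropical rank two, where $D_A$ is the set of symmetric matrices $B$ such that each symmetric $3\times3$ tropical minor attains its minimum at $B$ at least at those monomials at which it does so at $A$. An \emph{$n+n$ symbic tree} is a finite tree without vertices of degree two, with leaves labeled $1,\dots,n,1',\dots,n'$ and positive lengths on its internal (non-leaf) edges, such that: the two parts obtained by removing any internal edge each contain both a leaf $i$ and a leaf $j'$; there is a length-preserving involution of the tree swapping $i$ and $i'$ for all $i$; and the fixed points of this involution on the metric tree form a path (possibly a single point, which may be the midpoint of a flipped edge). Two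 symbic trees have the same combinatorial type if there is an isomorphism of the underlying trees that preserves the labels. A symmetric matrix $A$ is associated with a symbic tree if, for a vertex $O$ of the tree and some $r,c\in\mathbb R^n$, for all $i,j$ the entry $A_{ij}$ equals $r_i+c_j$ plus the total length of the internal edges common to the path from $O$ to $i$ and the path from $O$ to $j'$ (the distance from $O$ to the point where these paths diverge). For a combinatorial type $T$ let $C_T$ be the set of symmetric matrices obtained in this way from $T$ when the internal edge lengths range over all involution-invariant nonnegative real numbers, and let $\Sigma_{\mathrm{symbic}}$ be the collection of all cones $C_T$. \textbf{Corollary.} Let $n\ge 0$. The fan structure $\Sigma_{\mathrm{symbic}}$ given by $n+n$ symbic trees refines the fan structure $\Sigma_{\min}$ of symmetric tropical rank two matrices given by the $3\times3$ minors. That is: the union of the cones $C_T$ is the set of all symmetric $n\times n$ matrices of symmetric tropical rank two, which is also the union of the cones of $\Sigma_{\min}$; each cone $C_T$ is contained in a cone of $\Sigma_{\min}$; and each cone of $\Sigma_{\min}$ is the union of the cones $C_T$ contained in it. Moreover, if $A$ and $B$ are symmetric matrices associated with symbic trees of the same combinatorial type (with positive internal edge lengths), then each symmetric $3\times3$ tropical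 minor attains its minimum at $A$ and at $B$ at the same monomials. -/

import Mathlib

/-! ### Symmetric tropical `3 × 3` minors -/

/-- A symmetric real `n × n` matrix, as a point of `ℝ^(n+1 choose 2)`: the entry in the positions
`(i, j)` and `(j, i)` is `x s(i, j)`. -/
abbrev SymMat (n : ℕ) : Type := Sym2 (Fin n) → ℝ

/-- The `3 × 3` minor, with rows `I` and columns `J`, of the symmetric `n × n` matrix of variables
`x_{ij} = x_{ji}`, as a polynomial in these `(n+1 choose 2)` variables. -/
noncomputable def symMinor {n : ℕ} (I J : Fin 3 ↪o Fin n) : MvPolynomial (Sym2 (Fin n)) ℚ :=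
  (Matrix.of fun a b : Fin 3 => MvPolynomial.X (R := ℚ) s(I a, J b)).det

/-- The value at `x` of the tropical monomial with exponent vector `m` (the ground field carries the
trivial valuation, so coefficients do not contribute). -/
noncomputable def tropMonomial {σ : Type*} (m : σ →₀ ℕ) (x : σ → ℝ) : ℝ :=
  m.sum fun e k => (k : ℝ) * x e

/-- The monomials of `f` at which the minimum in the tropical polynomial `trop(f)(x)` is attained. -/
def minMonomials {σ : Type*} (f : MvPolynomial σ ℚ) (x : σ → ℝ) : Set (σ →₀ ℕ) :=
  {m | m ∈ f.support ∧ ∀ m' ∈ f.support, tropMonomial m x ≤ tropMonomial m' x}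

/-- `x` has symmetric tropical rank (at most) two: in every symmetric tropical `3 × 3` minor the
minimum is attained by at least two monomials. -/
def SymTropRankTwo {n : ℕ} (x : SymMat n) : Prop :=
  ∀ I J : Fin 3 ↪o Fin n, (minMonomials (symMinor I J) x).Nontrivial

/-- The closed cone of the minor fan having `x` in its relative interior: the matrices for which the
minimum in each symmetric tropical `3 × 3` minor is attained at least at the monomials at which it
is attained for `x`. -/
def minorCone {n : ℕ} (x : SymMat n) : Set (SymMat n) :=
  {y | ∀ I J : Fin 3 ↪o Fin n, minMonomials (symMinor I J) x ⊆ minMonomials (symMinor I J) y}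

/-- The fan structure given by the `3 × 3` minors on the space of symmetric matrices of symmetric
tropical rank two. -/
def minorFan (n : ℕ) : Set (Set (SymMat n)) :=
  {C | ∃ x : SymMat n, SymTropRankTwo x ∧ C = minorCone x}

/-! ### Symbic trees -/

/-- A finite tree without vertices of degree two, whose leaves (vertices of degree one) are labeled
bijectively by `1, …, n` (`Sum.inl`) and `1', …, n'` (`Sum.inr`). -/
structure LabeledTree (n : ℕ) where
  V : Type
  finite : Finite V
  graph : SimpleGraph V
  isTree : graph.IsTree
  leaf : Fin n ⊕ Fin n → V
  leaf_injective : Function.Injective leaf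
  degree_eq_one_iff : ∀ v, (graph.neighborSet v).ncard = 1 ↔ v ∈ Set.range leaf
  degree_ne_two : ∀ v, (graph.neighborSet v).ncard ≠ 2

namespace LabeledTree

variable {n : ℕ}

/-- The internal edges: those with no leaf as an endpoint. -/
def internalEdges (T : LabeledTree n) : Set (Sym2 T.V) :=
  {e | e ∈ T.graph.edgeSet ∧ ∀ a, T.leaf a ∉ e}

/-- The part of the tree that contains the vertex `v` after the edge `e` is removed. -/
def side (T : LabeledTree n) (e : Sym2 T.V) (v : T.V) : Set T.V :=
  {w | (T.graph.deleteEdges {e}).Reachable v w}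

/-- Every split contains both colors on both sides. -/
def IsBicolored (T : LabeledTree n) : Prop :=
  ∀ e ∈ T.internalEdges, ∀ v ∈ e,
    (∃ i, T.leaf (Sum.inl i) ∈ T.side e v) ∧ (∃ j, T.leaf (Sum.inr j) ∈ T.side e v)

/-- The edges on the path from `u` to `v`. -/
def pathEdges (T : LabeledTree n) (u v : T.V) : Set (Sym2 T.V) :=
  {e | ∃ p : T.graph.Walk u v, p.IsPath ∧ e ∈ p.edges}

/-- For internal edge lengths `ℓ`, the length of the path from `O` to the point where the paths from
`O` to the leaf `i` and from `O` to the leaf `j'` diverge, that is, the total length of the internal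
edges which the two paths have in common. -/
noncomputable def commonLength (T : LabeledTree n) (ℓ : Sym2 T.V → ℝ) (O : T.V)
    (i j : Fin n) : ℝ :=
  ∑ᶠ e ∈ T.internalEdges ∩ T.pathEdges O (T.leaf (Sum.inl i)) ∩
    T.pathEdges O (T.leaf (Sum.inr j)), ℓ e

/-- The symmetric matrix `x` is associated with the tree `T` with internal edge lengths `ℓ`: up to
tropical scaling of rows and columns, its `(i, j)` entry is the distance from an origin `O` to the
point where the paths from `O` to `i` and to `j'` diverge. (A change of the origin only scales rows
and columns.) -/
def IsMatrixOf (T : LabeledTree n) (ℓ : Sym2 T.V → ℝ) (x : SymMat n) : Prop :=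
  ∃ (O : T.V) (r c : Fin n → ℝ), ∀ i j, x s(i, j) = T.commonLength ℓ O i j + r i + c j

end LabeledTree

/-- The combinatorial type of an `n + n` symbic tree: each split contains both colors on both sides,
the tree has an involution swapping `i` and `i'` for all `i`, and the fixed points of the involution
form a path. If no vertex is fixed then the involution flips an edge, whose midpoint is its only
fixed point; otherwise the fixed points are the fixed vertices and the edges between them. -/
structure SymbicTree (n : ℕ) extends LabeledTree n where
  bicolored : toLabeledTree.IsBicolored
  swap : graph ≃g graph
  swap_involutive : Function.Involutive swap
  swap_leaf : ∀ a, swap (leaf a) = leaf a.swap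
  fixed_path : {w | swap w = w} = ∅ ∨
    ∃ (u v : V) (p : graph.Walk u v), p.IsPath ∧ {w | swap w = w} = {w | w ∈ p.support}

namespace SymbicTree

variable {n : ℕ}

/-- The symbic trees `T` and `T'` have the same combinatorial type: there is an isomorphism of
trees that preserves the leaf labels. -/
def SameType (T T' : SymbicTree n) : Prop :=
  ∃ φ : T.graph ≃g T'.graph, ∀ a, φ (T.leaf a) = T'.leaf a

/-- The edge lengths are symmetric with respect to the involution. -/
def SymmetricLengths (T : SymbicTree n) (ℓ : Sym2 T.V → ℝ) : Prop :=
  ∀ e ∈ T.internalEdges, ℓ (e.map T.swap) = ℓ e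

/-- The symmetric matrices associated with the metric symbic trees of combinatorial type `T`, whose
internal edges have positive lengths. -/
def openCone (T : SymbicTree n) : Set (SymMat n) :=
  {x | ∃ ℓ : Sym2 T.V → ℝ, T.SymmetricLengths ℓ ∧ (∀ e ∈ T.internalEdges, 0 < ℓ e) ∧
    T.IsMatrixOf ℓ x}

/-- The closed cone of `T`, in which internal edge lengths may also be zero. -/
def cone (T : SymbicTree n) : Set (SymMat n) :=
  {x | ∃ ℓ : Sym2 T.V → ℝ, T.SymmetricLengths ℓ ∧ (∀ e ∈ T.internalEdges, 0 ≤ ℓ e) ∧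
    T.IsMatrixOf ℓ x}

end SymbicTree

/-- The fan structure given by `n + n` symbic trees. -/
def symbicFan (n : ℕ) : Set (Set (SymMat n)) :=
  {C | ∃ T : SymbicTree n, C = T.cone}

/-! ### Refinement -/

/-- The family `F` of cones refines the family `G`: they have the same support, every cone of `F`
lies in a cone of `G`, and every cone of `G` is a union of cones of `F`. -/
def FanRefines {E : Type*} (F G : Set (Set E)) : Prop :=
  ⋃₀ F = ⋃₀ G ∧ (∀ C ∈ F, ∃ D ∈ G, C ⊆ D) ∧ ∀ D ∈ G, ⋃₀ {C | C ∈ F ∧ C ⊆ D} = D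

/-! Moving the origin of a tree only scales rows and columns (`exists_scaling`), and scaling adds
one constant to all terms of a given minor. For three rows and three columns, take as origin a
median `v` of the six leaves: no branch at `v` contains more than three of them. All entries are
then nonnegative up to scaling, and for positive lengths an entry is zero exactly when its two
leaves lie in different branches. So the minimizing terms are the permutations matching rows to
columns in different branches, and a finite check finds two of them (`exists_center`). Their
monomials can coincide only in a principal minor where three branches at `v` each contain a pair
`i`, `i'`. The involution then fixes `v` and three of its neighbors, which is impossible if the
fixed points form a path (`exists_minorExponent_ne`). Since the minimizing terms are read off from
the branches, they depend only on the combinatorial type, and letting lengths become zero can only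
add terms. Hence each cone of a tree lies in a minor cone.

Conversely, subtract `r i + r j` from a rank two matrix so that it becomes nonnegative with a zero
in each row (`exists_tight`). The minors then give a bipartite ultrametric inequality
(`SymTropRankTwo.min_le`), and the matrix extends to an ultrametric similarity on all `2n` labels,
invariant under the exchange of colors. Its balls are nested or disjoint, so they form a tree, and
this tree gives back the matrix (`commonLength_labeledTree_eq`). The exchange of colors acts on the
tree. A fixed vertex with three fixed neighbors would produce a principal minor minimized only by
the two 3-cycles, which are one and the same monomial; so rank two forces the fixed points to form a
path.

Every rank two matrix therefore lies in an open cone. The refinement follows formally: for `y` in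
the minor cone of `x`, the cone of the tree of `y` lies in the minor cone of `y`, hence in that of
`x`. -/

/-! ### Edges on the paths of a tree -/

namespace SimpleGraph

variable {V V' : Type*} {G : SimpleGraph V} {G' : SimpleGraph V'}

/-- The edges on the paths from `u` to `v`. -/
def pathEdges (G : SimpleGraph V) (u v : V) : Set (Sym2 V) :=
  {e | ∃ p : G.Walk u v, p.IsPath ∧ e ∈ p.edges}

lemma pathEdges_self (u : V) : G.pathEdges u u = ∅ := by
  ext e
  simp only [pathEdges, Set.mem_ofPred_eq, Set.mem_empty_iff_false, iff_false]
  rintro ⟨p, hp, he⟩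
  cases Walk.isPath_iff_nil.1 hp
  simp at he

lemma pathEdges_comm (u v : V) : G.pathEdges u v = G.pathEdges v u := by
  have key : ∀ u v, G.pathEdges u v ⊆ G.pathEdges v u := by
    rintro u v e ⟨p, hp, he⟩
    exact ⟨p.reverse, hp.reverse, by simpa using he⟩
  exact (key u v).antisymm (key v u)

lemma IsTree.mem_pathEdges_of_isPath (hG : G.IsTree) {u v : V} {p : G.Walk u v} (hp : p.IsPath)
    {e : Sym2 V} : e ∈ G.pathEdges u v ↔ e ∈ p.edges := by
  refine ⟨?_, fun h => ⟨p, hp, h⟩⟩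
  rintro ⟨q, hq, he⟩
  rwa [(hG.existsUnique_path u v).unique hp hq]

lemma IsTree.exists_isPath (hG : G.IsTree) (u v : V) : ∃ p : G.Walk u v, p.IsPath :=
  (hG.existsUnique_path u v).exists

lemma IsTree.mem_pathEdges_iff_not_reachable (hG : G.IsTree) {u v : V} {e : Sym2 V} :
    e ∈ G.pathEdges u v ↔ ¬ (G.deleteEdges {e}).Reachable u v := by
  classical
  obtain ⟨p, hp⟩ := hG.exists_isPath u v
  rw [hG.mem_pathEdges_of_isPath hp]
  constructor
  · rintro he ⟨q⟩
    have hq : (q.toPath.1.map (Hom.ofLE (G.deleteEdges_le {e}))).IsPath :=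
      q.toPath.2.mapLe (G.deleteEdges_le {e})
    rw [(hG.existsUnique_path u v).unique hp hq, Walk.edges_map] at he
    simp only [List.mem_map] at he
    obtain ⟨e', he', h⟩ := he
    obtain rfl : e' = e := by simpa using h
    have := q.toPath.1.edges_subset_edgeSet he'
    simp [edgeSet_deleteEdges] at this
  · intro h
    by_contra he
    exact h ⟨p.toDeleteEdge e he⟩

/-- Every vertex still reaches one of the two ends of the deleted edge, so at most two components
remain. -/
lemma Connected.reachable_deleteEdges_of_not (hG : G.Connected) {e : Sym2 V} {u v w : V}
    (huv : ¬ (G.deleteEdges {e}).Reachable u v) (hvw : ¬ (G.deleteEdges {e}).Reachable v w) :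
    (G.deleteEdges {e}).Reachable u w := by
  induction e with | _ y z =>
  have key : ∀ a, (G.deleteEdges {s(y, z)}).Reachable a y ∨
      (G.deleteEdges {s(y, z)}).Reachable a z := by
    intro a
    obtain ⟨p⟩ := hG.preconnected a y
    induction p with
    | nil => exact Or.inl (Reachable.refl _)
    | @cons a b c h p ih =>
      by_cases hab : s(a, b) = s(c, z)
      · rcases Sym2.eq_iff.1 hab with ⟨rfl, rfl⟩ | ⟨rfl, rfl⟩
        · exact Or.inl (Reachable.refl _)
        · exact Or.inr (Reachable.refl _)
      · have hr : (G.deleteEdges {s(c, z)}).Reachable a b :=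
          Adj.reachable (by simp [deleteEdges_adj, h, hab])
        exact (ih huv hvw).imp hr.trans hr.trans
  rcases key u with hu | hu <;> rcases key v with hv | hv <;> rcases key w with hw | hw <;>
    first
      | exact hu.trans hw.symm
      | exact absurd (hu.trans hv.symm) huv
      | exact absurd (hv.trans hw.symm) hvw

/-- An edge has two sides, and it lies on a path exactly when the ends are on different sides. This
reduces most of the tree geometry below to propositional logic. -/
lemma IsTree.mem_pathEdges_iff_xor (hG : G.IsTree) (u v w : V) (e : Sym2 V) :
    e ∈ G.pathEdges u w ↔ ¬ (e ∈ G.pathEdges u v ↔ e ∈ G.pathEdges v w) := by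
  simp only [hG.mem_pathEdges_iff_not_reachable]
  have h1 : (G.deleteEdges {e}).Reachable u v → (G.deleteEdges {e}).Reachable v w →
    (G.deleteEdges {e}).Reachable u w := fun h h' => h.trans h'
  have h2 : (G.deleteEdges {e}).Reachable u v → (G.deleteEdges {e}).Reachable u w →
    (G.deleteEdges {e}).Reachable v w := fun h h' => h.symm.trans h'
  have h3 : (G.deleteEdges {e}).Reachable v w → (G.deleteEdges {e}).Reachable u w →
    (G.deleteEdges {e}).Reachable u v := fun h h' => h'.trans h.symm
  have h4 : ¬ (G.deleteEdges {e}).Reachable u v → ¬ (G.deleteEdges {e}).Reachable v w →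
    (G.deleteEdges {e}).Reachable u w := hG.connected.reachable_deleteEdges_of_not
  tauto

lemma IsTree.pathEdges_adj (hG : G.IsTree) {u v : V} (h : G.Adj u v) :
    G.pathEdges u v = {s(u, v)} := by
  ext e
  rw [hG.mem_pathEdges_of_isPath (Path.singleton h).2]
  simp [Path.singleton]

lemma IsTree.exists_adj_mem_pathEdges (hG : G.IsTree) {v a : V} (h : v ≠ a) :
    ∃ w, G.Adj v w ∧ s(v, w) ∈ G.pathEdges v a := by
  obtain ⟨p, hp⟩ := hG.exists_isPath v a
  cases p with
  | nil => exact absurd rfl h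
  | @cons _ w _ hw p => exact ⟨w, hw, _, hp, by simp⟩

lemma IsTree.eq_of_mem_pathEdges (hG : G.IsTree) {v a w w' : V}
    (h : s(v, w) ∈ G.pathEdges v a) (h' : s(v, w') ∈ G.pathEdges v a) : w = w' := by
  obtain ⟨p, hp⟩ := hG.exists_isPath v a
  rw [hG.mem_pathEdges_of_isPath hp] at h h'
  cases p with
  | nil => simp at h
  | @cons _ x _ hx p =>
    rw [Walk.cons_isPath_iff] at hp
    have key : ∀ w, s(v, w) ∈ (Walk.cons hx p).edges → w = x := by
      intro w h
      rw [Walk.edges_cons, List.mem_cons] at h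
      rcases h with h | h
      · exact Sym2.congr_right.1 h
      · exact absurd (p.fst_mem_support_of_mem_edges h) hp.2
    rw [key w h, key w' h']

lemma IsTree.pathEdges_subset_of_mem (hG : G.IsTree) {u v y z : V}
    (h : s(y, z) ∈ G.pathEdges u v) : G.pathEdges u y ⊆ G.pathEdges u v := by
  classical
  obtain ⟨p, hp⟩ := hG.exists_isPath u v
  rw [hG.mem_pathEdges_of_isPath hp] at h
  have hy := p.fst_mem_support_of_mem_edges h
  intro e he
  rw [hG.mem_pathEdges_of_isPath hp]
  rw [hG.mem_pathEdges_of_isPath (hp.takeUntil hy)] at he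
  exact p.edges_takeUntil_subset_edges hy he

/-- Two paths starting in `v` that share an edge share their first edge. -/
lemma IsTree.exists_first_edge (hG : G.IsTree) {v a b : V} {e : Sym2 V}
    (ha : e ∈ G.pathEdges v a) (hb : e ∈ G.pathEdges v b) :
    ∃ w, G.Adj v w ∧ s(v, w) ∈ G.pathEdges v a ∧ s(v, w) ∈ G.pathEdges v b := by
  have hva : v ≠ a := by
    rintro rfl
    simp [pathEdges_self] at ha
  obtain ⟨w, hw, hf⟩ := hG.exists_adj_mem_pathEdges hva
  refine ⟨w, hw, hf, ?_⟩
  by_contra hfb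
  induction e with | _ y z =>
  have h1 : s(v, w) ∉ G.pathEdges v y := fun h => hfb (hG.pathEdges_subset_of_mem hb h)
  have hvw := hG.pathEdges_adj hw
  have hne : s(y, z) ≠ s(v, w) := fun h => hfb (h ▸ hb)
  have h2 : s(y, z) ∈ G.pathEdges w a := by
    rw [hG.mem_pathEdges_iff_xor w v a, pathEdges_comm w v, hvw]
    simp [hne, ha]
  have h3 : s(v, w) ∉ G.pathEdges w a := by
    rw [hG.mem_pathEdges_iff_xor w v a, pathEdges_comm w v, hvw]
    simp [hf]
  have h4 : s(v, w) ∉ G.pathEdges w y := fun h => h3 (hG.pathEdges_subset_of_mem h2 h)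
  rw [hG.mem_pathEdges_iff_xor w v y, pathEdges_comm w v, hvw] at h4
  simp [h1] at h4

/-- For the converse: the first edge from `z` towards `u` is not on the path from `z` to `v`, so it
separates `u` from `v` and lies on `p`. -/
lemma IsTree.mem_support_iff (hG : G.IsTree) {u v z : V} {p : G.Walk u v} (hp : p.IsPath) :
    z ∈ p.support ↔ Disjoint (G.pathEdges z u) (G.pathEdges z v) := by
  classical
  constructor
  · intro hz
    rw [Set.disjoint_left]
    intro e he he'
    rw [pathEdges_comm, hG.mem_pathEdges_of_isPath (hp.takeUntil hz)] at he
    rw [hG.mem_pathEdges_of_isPath (hp.dropUntil hz)] at he'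
    exact hp.isTrail.disjoint_edges_takeUntil_dropUntil hz he he'
  · intro h
    by_cases hzu : z = u
    · simp [hzu]
    obtain ⟨w, -, hw⟩ := hG.exists_adj_mem_pathEdges hzu
    have h2 : s(z, w) ∈ G.pathEdges u v := by
      rw [hG.mem_pathEdges_iff_xor u z v, pathEdges_comm u z]
      simp [hw, Set.disjoint_left.1 h hw]
    rw [hG.mem_pathEdges_of_isPath hp] at h2
    exact p.fst_mem_support_of_mem_edges h2

lemma mem_pathEdges_map (φ : G ≃g G') {u v : V} {e : Sym2 V} (h : e ∈ G.pathEdges u v) :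
    e.map φ ∈ G'.pathEdges (φ u) (φ v) := by
  obtain ⟨p, hp, he⟩ := h
  refine ⟨p.map φ.toHom, hp.map φ.injective, ?_⟩
  rw [Walk.edges_map]
  exact List.mem_map.2 ⟨e, he, rfl⟩

lemma map_mem_pathEdges_iff (φ : G ≃g G') {u v : V} {e : Sym2 V} :
    e.map φ ∈ G'.pathEdges (φ u) (φ v) ↔ e ∈ G.pathEdges u v := by
  refine ⟨fun h => ?_, mem_pathEdges_map φ⟩
  have := mem_pathEdges_map φ.symm h
  simpa [Sym2.map_map, Function.comp_def] using this

/-- For a neighbor `w` of `v`, the sets of edges on the paths to `a` from `v` and from `w` differ in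
the edge between `v` and `w`. -/
lemma IsTree.ncard_pathEdges_of_adj [Finite V] (hG : G.IsTree) {v w : V} (h : G.Adj v w) (a : V) :
    (s(v, w) ∈ G.pathEdges v a → (G.pathEdges w a).ncard + 1 = (G.pathEdges v a).ncard) ∧
    (G.pathEdges w a).ncard ≤ (G.pathEdges v a).ncard + 1 := by
  have hx := fun e => hG.mem_pathEdges_iff_xor w v a e
  simp only [pathEdges_comm w v, hG.pathEdges_adj h, Set.mem_singleton_iff] at hx
  constructor
  · intro hm
    have : G.pathEdges w a = G.pathEdges v a \ {s(v, w)} := by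
      ext e
      rw [hx e, Set.mem_sdiff, Set.mem_singleton_iff]
      by_cases he : e = s(v, w)
      · simp [he, hm]
      · simp [he]
    rw [this, Set.ncard_sdiff_singleton_add_one hm (Set.toFinite _)]
  · refine (Set.ncard_le_ncard (t := insert s(v, w) (G.pathEdges v a)) ?_ (Set.toFinite _)).trans
      (Set.ncard_insert_le _ _)
    intro e he
    rw [hx e] at he
    rw [Set.mem_insert_iff]
    tauto

/-- A median of finitely many vertices: each branch contains at most half of them. -/
lemma IsTree.exists_median [Finite V] (hG : G.IsTree) {ι : Type*} [Fintype ι] (a : ι → V) :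
    ∃ v, ∀ w, G.Adj v w → 2 * {i | s(v, w) ∈ G.pathEdges v (a i)}.ncard ≤ Fintype.card ι := by
  classical
  have := hG.connected.nonempty
  -- The median minimizes the total number of edges to the given vertices.
  obtain ⟨v, hv⟩ := Finite.exists_min (fun v => ∑ i, (G.pathEdges v (a i)).ncard)
  refine ⟨v, fun w hw => ?_⟩
  -- A step from `v` to `w` shortens by one the paths into the branch of `w` and lengthens the
  -- others by at most one; the 2 is the difference between these changes.
  have hle : ∑ i, ((G.pathEdges w (a i)).ncard +
      (if s(v, w) ∈ G.pathEdges v (a i) then 2 else 0)) ≤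
      ∑ i, ((G.pathEdges v (a i)).ncard + 1) := by
    refine Finset.sum_le_sum fun i _ => ?_
    have := hG.ncard_pathEdges_of_adj hw (a i)
    split_ifs with h
    · have := this.1 h
      omega
    · simpa using this.2
  rw [Finset.sum_add_distrib, Finset.sum_add_distrib, ← Finset.sum_filter] at hle
  have hmin := hv w
  rw [Set.ncard_eq_toFinset_card']
  simp only [Finset.sum_const, smul_eq_mul, Finset.card_univ, Set.toFinset_ofPred] at hle hmin ⊢
  omega

/-- Half of three, rounded down, is one: each branch at the median contains at most one of the three
vertices. -/
lemma IsTree.pairwise_disjoint_of_median [Finite V] (hG : G.IsTree) (a : Fin 3 → V) :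
    ∃ v, ∀ i j, i ≠ j → Disjoint (G.pathEdges v (a i)) (G.pathEdges v (a j)) := by
  obtain ⟨v, hv⟩ := hG.exists_median a
  refine ⟨v, fun i j hij => Set.disjoint_left.2 fun e hi hj => ?_⟩
  obtain ⟨w, hw, h1, h2⟩ := hG.exists_first_edge hi hj
  have h3 := hv w hw
  have : 2 ≤ {i | s(v, w) ∈ G.pathEdges v (a i)}.ncard := by
    rw [← Set.ncard_pair hij]
    refine Set.ncard_le_ncard ?_ (Set.toFinite _)
    rintro k (rfl | rfl)
    exacts [h1, h2]
  simp at h3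
  omega

/-- In a tree, the neighbors of a vertex of a path that lie on the path are at most two. -/
lemma IsTree.not_three_neighbors_mem_support (hG : G.IsTree) {u u' v : V} {p : G.Walk u u'}
    (hp : p.IsPath) {w : Fin 3 → V} (hw : Function.Injective w) (hadj : ∀ a, G.Adj v (w a))
    (hmem : ∀ a, w a ∈ p.support) : False := by
  -- The paths from `w a` to the two ends are disjoint, so the edge to `v` is missing from one of
  -- them and hence points from `v` to that end. Three edges at `v` cannot point to two ends.
  have key : ∀ a, s(v, w a) ∈ G.pathEdges v u ∨ s(v, w a) ∈ G.pathEdges v u' := by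
    intro a
    have h := (hG.mem_support_iff hp).1 (hmem a)
    have h1 := hG.mem_pathEdges_iff_xor (w a) v u s(v, w a)
    have h2 := hG.mem_pathEdges_iff_xor (w a) v u' s(v, w a)
    rw [pathEdges_comm (w a) v, hG.pathEdges_adj (hadj a)] at h1 h2
    simp only [Set.mem_singleton_iff, true_iff] at h1 h2
    by_contra! hc
    exact Set.disjoint_left.1 h (h1.2 hc.1) (h2.2 hc.2)
  have h1 : ∀ a b, s(v, w a) ∈ G.pathEdges v u → s(v, w b) ∈ G.pathEdges v u → a = b :=
    fun a b ha hb => hw (hG.eq_of_mem_pathEdges ha hb)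
  have h2 : ∀ a b, s(v, w a) ∈ G.pathEdges v u' → s(v, w b) ∈ G.pathEdges v u' → a = b :=
    fun a b ha hb => hw (hG.eq_of_mem_pathEdges ha hb)
  rcases key 0 with a0 | a0 <;> rcases key 1 with a1 | a1 <;> rcases key 2 with a2 | a2 <;>
    first
      | exact absurd (h1 0 1 a0 a1) (by decide)
      | exact absurd (h1 0 2 a0 a2) (by decide)
      | exact absurd (h1 1 2 a1 a2) (by decide)
      | exact absurd (h2 0 1 a0 a1) (by decide)
      | exact absurd (h2 0 2 a0 a2) (by decide)
      | exact absurd (h2 1 2 a1 a2) (by decide)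

/-- A nonempty set of vertices of a finite tree that is closed under taking paths and has no vertex
with three neighbors in the set consists of the vertices of a path. -/
lemma IsTree.exists_isPath_support_eq [Finite V] (hG : G.IsTree) {F : Set V} (hF : F.Nonempty)
    (hconv : ∀ u ∈ F, ∀ v ∈ F, ∀ p : G.Walk u v, p.IsPath → ∀ z ∈ p.support, z ∈ F)
    (hbr : ∀ v ∈ F, ∀ w : Fin 3 → V, Function.Injective w → (∀ a, G.Adj v (w a)) →
      (∀ a, w a ∈ F) → False) :
    ∃ (u v : V) (p : G.Walk u v), p.IsPath ∧ F = {z | z ∈ p.support} := by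
  classical
  have hne : Nonempty F := hF.to_subtype
  -- A longest path in `F` is all of `F`: the median `m` of its ends and a further `y ∈ F` is `y`
  -- itself, or is an end, so that the path could be prolonged to `y`, or has three neighbors in
  -- `F`.
  obtain ⟨⟨⟨u, hu⟩, ⟨v, hv⟩⟩, hmax⟩ := Finite.exists_max
    (fun q : F × F => (G.pathEdges q.1.1 q.2.1).ncard)
  obtain ⟨p, hp⟩ := hG.exists_isPath u v
  refine ⟨u, v, p, hp, ?_⟩
  refine Set.Subset.antisymm (fun y hy => ?_) fun z hz => hconv u hu v hv p hp z hz
  rw [Set.mem_ofPred_eq, hG.mem_support_iff hp]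
  obtain ⟨m, hm⟩ := hG.pairwise_disjoint_of_median ![u, v, y]
  have huv := hm 0 1 (by decide)
  have huy := hm 0 2 (by decide)
  have hvy := hm 1 2 (by decide)
  simp only [Matrix.cons_val_zero, Matrix.cons_val_one, Matrix.cons_val] at huv huy hvy
  have hmF : m ∈ F := hconv u hu v hv p hp m ((hG.mem_support_iff hp).2 huv)
  have hgrow : ∀ u v, Disjoint (G.pathEdges u v) (G.pathEdges u y) → u ≠ y →
      (G.pathEdges v u).ncard < (G.pathEdges v y).ncard := by
    intro u v hd hne
    refine Set.ncard_lt_ncard ⟨fun e he => ?_, fun hsub => ?_⟩ (Set.toFinite _)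
    · rw [hG.mem_pathEdges_iff_xor v u y]
      rw [pathEdges_comm v u] at he ⊢
      simp [he, Set.disjoint_left.1 hd he]
    · obtain ⟨w, -, hw⟩ := hG.exists_adj_mem_pathEdges hne
      have h1 := Set.disjoint_right.1 hd hw
      rw [pathEdges_comm u v] at h1
      refine h1 (hsub ?_)
      rw [hG.mem_pathEdges_iff_xor v u y]
      simp [hw, h1]
  by_cases hmy : m = y
  · rwa [← hmy]
  by_cases hmu : m = u
  · have h1 := hgrow u v (hmu ▸ hvy) (hmu ▸ hmy)
    have h2 := hmax ⟨⟨v, hv⟩, ⟨y, hy⟩⟩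
    simp only [pathEdges_comm u v] at h2
    omega
  by_cases hmv : m = v
  · have h1 := hgrow v u (hmv ▸ huy) (hmv ▸ hmy)
    have h2 := hmax ⟨⟨u, hu⟩, ⟨y, hy⟩⟩
    simp only at h2
    omega
  exfalso
  have hstep : ∀ x ∈ F, m ≠ x → ∃ w ∈ F, G.Adj m w ∧ s(m, w) ∈ G.pathEdges m x := by
    intro x hx hmx
    obtain ⟨w, hw, hwx⟩ := hG.exists_adj_mem_pathEdges hmx
    obtain ⟨q, hq⟩ := hG.exists_isPath m x
    refine ⟨w, hconv m hmF x hx q hq w ?_, hw, hwx⟩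
    rw [hG.mem_pathEdges_of_isPath hq] at hwx
    exact q.snd_mem_support_of_mem_edges hwx
  obtain ⟨wu, hwu, au, eu⟩ := hstep u hu hmu
  obtain ⟨wv, hwv, av, ev⟩ := hstep v hv hmv
  obtain ⟨wy, hwy, ay, ey⟩ := hstep y hy hmy
  have n1 : wu ≠ wv := fun h => Set.disjoint_left.1 huv eu (h ▸ ev)
  have n2 : wu ≠ wy := fun h => Set.disjoint_left.1 huy eu (h ▸ ey)
  have n3 : wv ≠ wy := fun h => Set.disjoint_left.1 hvy ev (h ▸ ey)
  refine hbr m hmF ![wu, wv, wy] ?_ ?_ ?_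
  · intro a b hab
    fin_cases a <;> fin_cases b <;> simp_all
  · intro a
    fin_cases a <;> simp_all
  · intro a
    fin_cases a <;> simp_all

end SimpleGraph

/-! ### Monomials of the symmetric minors -/

/-- The exponent vector of the term of the permutation `σ` in the minor with rows `I` and
columns `J`. -/
noncomputable def minorExponent {n : ℕ} (I J : Fin 3 ↪o Fin n) (σ : Equiv.Perm (Fin 3)) :
    Sym2 (Fin n) →₀ ℕ :=
  ∑ a, Finsupp.single s(I (σ a), J a) 1

section Minor

variable {n : ℕ} {I J : Fin 3 ↪o Fin n} {σ τ : Equiv.Perm (Fin 3)}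

lemma tropMonomial_add {ι : Type*} (m m' : ι →₀ ℕ) (x : ι → ℝ) :
    tropMonomial (m + m') x = tropMonomial m x + tropMonomial m' x := by
  classical
  exact Finsupp.sum_add_index' (by simp) (by intros; push_cast; ring)

lemma tropMonomial_single {ι : Type*} (e : ι) (x : ι → ℝ) :
    tropMonomial (Finsupp.single e 1) x = x e := by
  simp [tropMonomial]

lemma tropMonomial_minorExponent (I J : Fin 3 ↪o Fin n) (σ : Equiv.Perm (Fin 3)) (x : SymMat n) :
    tropMonomial (minorExponent I J σ) x = ∑ a, x s(I (σ a), J a) := by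
  simp [minorExponent, Fin.sum_univ_three, tropMonomial_add, tropMonomial_single]

/-- The variable of `σ` in column `a` also occurs in the term of `τ`. As `σ a ≠ τ a`, it occurs
there in another column, with row and column index exchanged. -/
lemma exists_of_minorExponent_eq (h : minorExponent I J σ = minorExponent I J τ) {a : Fin 3}
    (ha : σ a ≠ τ a) : ∃ b, b ≠ a ∧ I (σ a) = J b ∧ I (τ b) = J a := by
  classical
  have h1 : 0 < minorExponent I J τ s(I (σ a), J a) := by
    rw [← h, minorExponent, Finsupp.finsetSum_apply]
    exact Finset.sum_pos' (fun _ _ => Nat.zero_le _) ⟨a, Finset.mem_univ _, by simp⟩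
  rw [minorExponent, Finsupp.finsetSum_apply] at h1
  obtain ⟨b, -, hb⟩ := Finset.exists_ne_zero_of_sum_ne_zero h1.ne'
  have hb' : s(I (τ b), J b) = s(I (σ a), J a) := by
    by_contra hc
    exact hb (Finsupp.single_eq_of_ne' hc)
  rcases Sym2.eq_iff.1 hb' with ⟨h2, h3⟩ | ⟨h2, h3⟩
  · obtain rfl := J.injective h3
    exact absurd (I.injective h2).symm ha
  · refine ⟨b, ?_, h3.symm, h2⟩
    rintro rfl
    exact ha (I.injective (h3.symm.trans h2.symm))

/-- If they agreed at `a`, they would differ by an exchange of two columns `b` and `c`, and both `I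
(σ b)` and `I (σ c)` would have to be `J a`. -/
lemma ne_of_minorExponent_eq (h : minorExponent I J σ = minorExponent I J τ) (hne : σ ≠ τ)
    (a : Fin 3) : σ a ≠ τ a := by
  intro ha
  have hcomb : ∀ (σ τ : Equiv.Perm (Fin 3)) (a : Fin 3), σ ≠ τ → σ a = τ a →
      ∃ b c, b ≠ c ∧ σ b = τ c ∧ σ c = τ b ∧ σ b ≠ τ b ∧ σ c ≠ τ c ∧
        ∀ d, d = a ∨ d = b ∨ d = c := by
    decide
  obtain ⟨b, c, hbc, h1, h2, h3, h4, hd⟩ := hcomb σ τ a hne ha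
  have key : ∀ b c, b ≠ c → σ b = τ c → σ c = τ b → σ b ≠ τ b →
      (∀ d, d = a ∨ d = b ∨ d = c) → I (σ b) = J a := by
    intro b c hbc h1 h2 h3 hd
    obtain ⟨d, hdb, h5, h6⟩ := exists_of_minorExponent_eq h h3
    rcases hd d with rfl | rfl | rfl
    · exact h5
    · exact absurd rfl hdb
    · rw [h1] at h5
      exact absurd (J.injective (h6.symm.trans h5)) hbc
  have h5 := key b c hbc h1 h2 h3 hd
  have h6 := key c b hbc.symm h2 h1 h4 (fun d => by rcases hd d with h | h | h <;> simp [h])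
  exact hbc (σ.injective (I.injective (h5.trans h6.symm)))

/-- Permutations of three elements that agree nowhere differ by a 3-cycle, which is even. -/
lemma sign_eq_of_minorExponent_eq (h : minorExponent I J σ = minorExponent I J τ) :
    σ.sign = τ.sign := by
  by_cases hne : σ = τ
  · rw [hne]
  have hcomb : ∀ σ τ : Equiv.Perm (Fin 3), (∀ a, σ a ≠ τ a) → σ.sign = τ.sign := by decide
  exact hcomb σ τ (ne_of_minorExponent_eq h hne)

/-- If two permutations give the same monomial then the permutation disagreeing with both of them
identifies the rows and the columns. -/
lemma row_eq_column_of_minorExponent_eq (h : minorExponent I J σ = minorExponent I J τ)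
    (hne : σ ≠ τ) {π : Equiv.Perm (Fin 3)} (hσ : ∀ a, σ a ≠ π a) (hτ : ∀ a, τ a ≠ π a)
    (a : Fin 3) : I (π a) = J a := by
  have hd := ne_of_minorExponent_eq h hne
  obtain ⟨b, hba, h1, h2⟩ := exists_of_minorExponent_eq h (hd a)
  have h3 : τ b = σ a ∨ τ b = τ a ∨ τ b = π a := by
    have : ∀ x y z w : Fin 3, x ≠ y → x ≠ z → y ≠ z → w = x ∨ w = y ∨ w = z := by decide
    exact this _ _ _ _ (hd a) (hσ a) (hτ a)
  rcases h3 with h3 | h3 | h3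
  · rw [h3, h1] at h2
    exact absurd (J.injective h2) hba
  · exact absurd (τ.injective h3) hba
  · rw [← h3, h2]

lemma symMinor_eq_sum (I J : Fin 3 ↪o Fin n) :
    symMinor I J = ∑ σ : Equiv.Perm (Fin 3),
      MvPolynomial.monomial (minorExponent I J σ) ((σ.sign : ℤ) : ℚ) := by
  rw [symMinor, Matrix.det_apply']
  refine Finset.sum_congr rfl fun σ _ => ?_
  have h1 : ∏ a, (Matrix.of fun a b : Fin 3 => MvPolynomial.X (R := ℚ) s(I a, J b)) (σ a) a =
      MvPolynomial.monomial (minorExponent I J σ) 1 := by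
    simp only [Matrix.of_apply, MvPolynomial.X]
    rw [minorExponent, MvPolynomial.monomial_sum_one]
  rw [h1]
  have h2 : (((σ.sign : ℤ) : MvPolynomial (Sym2 (Fin n)) ℚ)) =
      MvPolynomial.C ((σ.sign : ℤ) : ℚ) := by simp
  rw [h2, MvPolynomial.C_mul_monomial, mul_one]

/-- Terms with the same monomial have the same sign, so in characteristic zero nothing cancels. -/
lemma mem_support_symMinor {m : Sym2 (Fin n) →₀ ℕ} :
    m ∈ (symMinor I J).support ↔ ∃ σ, minorExponent I J σ = m := by
  classical
  rw [MvPolynomial.mem_support_iff, symMinor_eq_sum, MvPolynomial.coeff_sum]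
  simp only [MvPolynomial.coeff_monomial]
  constructor
  · intro h
    obtain ⟨σ, -, hσ⟩ := Finset.exists_ne_zero_of_sum_ne_zero h
    exact ⟨σ, by by_contra hc; simp [hc] at hσ⟩
  · rintro ⟨σ, rfl⟩
    have h1 : ∀ τ, (if minorExponent I J τ = minorExponent I J σ then ((τ.sign : ℤ) : ℚ) else 0) =
        ((σ.sign : ℤ) : ℚ) * (if minorExponent I J τ = minorExponent I J σ then 1 else 0) := by
      intro τ
      split_ifs with h
      · rw [sign_eq_of_minorExponent_eq h, mul_one]
      · simp
    rw [Finset.sum_congr rfl fun τ _ => h1 τ, ← Finset.mul_sum]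
    refine mul_ne_zero (by simp) (ne_of_gt ?_)
    exact Finset.sum_pos' (fun τ _ => by positivity) ⟨σ, Finset.mem_univ _, by simp⟩

lemma mem_minMonomials_symMinor {x : SymMat n} {m : Sym2 (Fin n) →₀ ℕ} :
    m ∈ minMonomials (symMinor I J) x ↔ ∃ σ, minorExponent I J σ = m ∧
      ∀ τ : Equiv.Perm (Fin 3), ∑ a, x s(I (σ a), J a) ≤ ∑ a, x s(I (τ a), J a) := by
  simp only [minMonomials, Set.mem_ofPred_eq, mem_support_symMinor]
  constructor
  · rintro ⟨⟨σ, rfl⟩, h⟩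
    refine ⟨σ, rfl, fun τ => ?_⟩
    simpa only [tropMonomial_minorExponent] using h _ ⟨τ, rfl⟩
  · rintro ⟨σ, rfl, h⟩
    refine ⟨⟨σ, rfl⟩, ?_⟩
    rintro _ ⟨τ, rfl⟩
    simpa only [tropMonomial_minorExponent] using h τ

/-- The two cyclic terms of a principal minor are equal. -/
lemma minorExponent_eq_of_derangement (hσ : ∀ a, σ a ≠ a) (hτ : ∀ a, τ a ≠ a) :
    minorExponent I I σ = minorExponent I I τ := by
  have hcomb : ∀ σ τ : Equiv.Perm (Fin 3), (∀ a, σ a ≠ a) → (∀ a, τ a ≠ a) →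
      σ = τ ∨ σ = τ⁻¹ := by decide
  rcases hcomb σ τ hσ hτ with rfl | rfl
  · rfl
  · rw [minorExponent, minorExponent, ← Equiv.sum_comp τ]
    refine Finset.sum_congr rfl fun a _ => ?_
    simp [Sym2.eq_swap]

set_option synthInstance.maxHeartbeats 400000 in
set_option synthInstance.maxSize 2000 in
-- The entry `m r c` records whether row `r` and column `c` are in the same class. Each hypothesis
-- excludes one kind of class with four members: a row and three columns, three rows and a column,
-- two of each.
lemma exists_perms_of_bool_matrix : ∀ m : Fin 3 → Fin 3 → Bool,
    (∀ r, ¬ (m r 0 ∧ m r 1 ∧ m r 2)) → (∀ c, ¬ (m 0 c ∧ m 1 c ∧ m 2 c)) →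
    (∀ r s c d, r ≠ s → c ≠ d → ¬ (m r c ∧ m s c ∧ m s d)) →
    ∃ σ τ : Equiv.Perm (Fin 3), σ ≠ τ ∧ (∀ a, ¬ m (σ a) a) ∧ (∀ a, ¬ m (τ a) a) ∧
    ((∃ a, σ a = τ a) ∨ ∃ π : Equiv.Perm (Fin 3), (∀ a, m (π a) a) ∧
      (∀ a, σ a ≠ π a) ∧ (∀ a, τ a ≠ π a)) := by
  decide +kernel

/-- If the six rows and columns are distributed to classes of size at most three, then there are two
permutations matching rows to columns of different classes, which either have a common value or
are the two that disagree with a permutation matching rows to columns of the same class. -/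
lemma exists_perms_avoiding {X : Type*} (f g : Fin 3 → X)
    (h : ∀ w, {r : Fin 3 ⊕ Fin 3 | Sum.elim f g r = w}.ncard ≤ 3) :
    ∃ σ τ : Equiv.Perm (Fin 3), σ ≠ τ ∧ (∀ a, f (σ a) ≠ g a) ∧ (∀ a, f (τ a) ≠ g a) ∧
      ((∃ a, σ a = τ a) ∨ ∃ π : Equiv.Perm (Fin 3), (∀ a, f (π a) = g a) ∧
        (∀ a, σ a ≠ π a) ∧ (∀ a, τ a ≠ π a)) := by
  classical
  let m : Fin 3 → Fin 3 → Bool := fun r c => decide (f r = g c)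
  have hcount : ∀ s : Finset (Fin 3 ⊕ Fin 3), s.card = 4 → ∀ w,
      (∀ r ∈ s, Sum.elim f g r = w) → False := by
    intro s hs w hw
    have h1 := h w
    have h2 : s.card ≤ {r : Fin 3 ⊕ Fin 3 | Sum.elim f g r = w}.ncard := by
      rw [← Set.ncard_coe_finset]
      exact Set.ncard_le_ncard (fun r hr => hw r hr) (Set.toFinite _)
    omega
  have hrow : ∀ r, ¬ (m r 0 ∧ m r 1 ∧ m r 2) := by
    rintro r ⟨h0, h1, h2⟩
    refine hcount {Sum.inl r, Sum.inr 0, Sum.inr 1, Sum.inr 2} (by simp) (f r) ?_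
    simp_all [m]
  have hcol : ∀ c, ¬ (m 0 c ∧ m 1 c ∧ m 2 c) := by
    rintro c ⟨h0, h1, h2⟩
    refine hcount {Sum.inr c, Sum.inl 0, Sum.inl 1, Sum.inl 2} (by simp) (g c) ?_
    simp_all [m]
  have hblock : ∀ r s c d, r ≠ s → c ≠ d → ¬ (m r c ∧ m s c ∧ m s d) := by
    rintro r s c d hrs hcd ⟨h1, h2, h3⟩
    refine hcount {Sum.inl r, Sum.inl s, Sum.inr c, Sum.inr d} ?_ (f r) ?_
    · simp [hrs, hcd]
    · simp_all [m]
  simpa [m] using exists_perms_of_bool_matrix m hrow hcol hblock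

end Minor

/-! ### Involutions of trees -/

namespace SimpleGraph

variable {V : Type*} {G : SimpleGraph V}

/-- Two paths from `v` share an edge exactly when they share their first edge; thus this is the
relation of lying in the same branch at `v`. -/
lemma IsTree.not_disjoint_trans (hG : G.IsTree) {v a b c : V}
    (h : ¬ Disjoint (G.pathEdges v a) (G.pathEdges v b))
    (h' : ¬ Disjoint (G.pathEdges v b) (G.pathEdges v c)) :
    ¬ Disjoint (G.pathEdges v a) (G.pathEdges v c) := by
  obtain ⟨e, ha, hb⟩ := Set.not_disjoint_iff.1 h
  obtain ⟨e', hb', hc⟩ := Set.not_disjoint_iff.1 h'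
  obtain ⟨w, -, h1, h2⟩ := hG.exists_first_edge ha hb
  obtain ⟨w', -, h3, h4⟩ := hG.exists_first_edge hb' hc
  obtain rfl := hG.eq_of_mem_pathEdges h2 h3
  exact Set.not_disjoint_iff.2 ⟨_, h1, h4⟩

/-- If an involution of a tree exchanges `x a` and `y a`, and these two are in the same branch at `v`
for each of three values of `a` that give different branches, then `v` and its neighbors in these
branches are fixed. -/
lemma IsTree.exists_fixed_neighbors (hG : G.IsTree) {s : G ≃g G} (hs : Function.Involutive s)
    {v : V} {x : Fin 3 → V}
    (hxy : ∀ a, ¬ Disjoint (G.pathEdges v (x a)) (G.pathEdges v (s (x a))))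
    (hx : ∀ a b, a ≠ b → Disjoint (G.pathEdges v (x a)) (G.pathEdges v (x b))) :
    s v = v ∧ ∃ w : Fin 3 → V, Function.Injective w ∧ (∀ a, G.Adj v (w a)) ∧
      ∀ a, s (w a) = w a := by
  have hmap : ∀ u a b, ¬ Disjoint (G.pathEdges u a) (G.pathEdges u b) →
      ¬ Disjoint (G.pathEdges (s u) (s a)) (G.pathEdges (s u) (s b)) := by
    intro u a b h
    obtain ⟨e, ha, hb⟩ := Set.not_disjoint_iff.1 h
    exact Set.not_disjoint_iff.2 ⟨_, mem_pathEdges_map s ha, mem_pathEdges_map s hb⟩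
  have hxy' : ∀ a, ¬ Disjoint (G.pathEdges v (s (x a))) (G.pathEdges v (x a)) :=
    fun a h => hxy a h.symm
  -- If `v` moved, two of the `x a` would be outside the branch of `s v`, hence in one branch seen
  -- from `s v`. Applying `s` puts their images in one branch at `v`, and so the two themselves, a
  -- contradiction.
  have hv : s v = v := by
    by_contra hne
    obtain ⟨a, b, hab, ha, hb⟩ : ∃ a b, a ≠ b ∧
        Disjoint (G.pathEdges v (x a)) (G.pathEdges v (s v)) ∧
        Disjoint (G.pathEdges v (x b)) (G.pathEdges v (s v)) := by
      have h : ∀ a b, a ≠ b → Disjoint (G.pathEdges v (x a)) (G.pathEdges v (s v)) ∨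
          Disjoint (G.pathEdges v (x b)) (G.pathEdges v (s v)) := by
        intro a b hab
        by_contra! hc
        exact hG.not_disjoint_trans hc.1 (fun h => hc.2 h.symm) (hx a b hab)
      by_cases h0 : Disjoint (G.pathEdges v (x 0)) (G.pathEdges v (s v))
      · rcases h 1 2 (by decide) with h1 | h1
        · exact ⟨0, 1, by decide, h0, h1⟩
        · exact ⟨0, 2, by decide, h0, h1⟩
      · exact ⟨1, 2, by decide, (h 0 1 (by decide)).resolve_left h0,
          (h 0 2 (by decide)).resolve_left h0⟩
    obtain ⟨z, -, hz⟩ := hG.exists_adj_mem_pathEdges (Ne.symm hne)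
    have key : ∀ a, Disjoint (G.pathEdges v (x a)) (G.pathEdges v (s v)) →
        s(v, z) ∈ G.pathEdges (s v) (x a) := by
      intro a ha
      rw [hG.mem_pathEdges_iff_xor (s v) v (x a), pathEdges_comm (s v) v]
      simp [hz, Set.disjoint_right.1 ha hz]
    have h1 := hmap (s v) (x a) (x b) (Set.not_disjoint_iff.2 ⟨_, key a ha, key b hb⟩)
    rw [hs v] at h1
    exact hG.not_disjoint_trans (hxy a) (hG.not_disjoint_trans h1 (hxy' b)) (hx a b hab)
  refine ⟨hv, ?_⟩
  have hstep : ∀ a, ∃ w, G.Adj v w ∧ s(v, w) ∈ G.pathEdges v (x a) ∧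
      s(v, w) ∈ G.pathEdges v (s (x a)) := by
    intro a
    obtain ⟨e, h1, h2⟩ := Set.not_disjoint_iff.1 (hxy a)
    exact hG.exists_first_edge h1 h2
  choose w hw hw1 hw2 using hstep
  refine ⟨w, fun a b hab => ?_, hw, fun a => ?_⟩
  · by_contra hne
    exact Set.disjoint_left.1 (hx a b hne) (hw1 a) (hab ▸ hw1 b)
  · have h := mem_pathEdges_map s (hw1 a)
    rw [Sym2.map_mk, hv] at h
    exact hG.eq_of_mem_pathEdges h (hw2 a)

end SimpleGraph

/-! ### The matrices associated with a tree -/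

namespace LabeledTree

variable {n : ℕ} (T : LabeledTree n)

/-- The paths from `v` to the leaves `i` and `j'` have an internal edge in common. -/
def Shares (v : T.V) (i j : Fin n) : Prop :=
  (T.internalEdges ∩ T.pathEdges v (T.leaf (Sum.inl i)) ∩
    T.pathEdges v (T.leaf (Sum.inr j))).Nonempty

open Classical in
lemma commonLength_eq_sum [Fintype T.internalEdges] (ℓ : Sym2 T.V → ℝ) (O : T.V) (i j : Fin n) :
    T.commonLength ℓ O i j = ∑ e ∈ T.internalEdges.toFinset,
      if e ∈ T.pathEdges O (T.leaf (Sum.inl i)) ∧ e ∈ T.pathEdges O (T.leaf (Sum.inr j))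
        then ℓ e else 0 := by
  rw [← Finset.sum_filter, commonLength, ← finsum_mem_coe_finset]
  refine finsum_mem_congr ?_ fun _ _ => rfl
  ext e
  simp only [Set.mem_inter_iff, Finset.coe_filter, Set.mem_toFinset, Set.mem_ofPred_eq, and_assoc]

lemma commonLength_of_not_shares (ℓ : Sym2 T.V → ℝ) {v : T.V} {i j : Fin n}
    (h : ¬ T.Shares v i j) : T.commonLength ℓ v i j = 0 := by
  rw [commonLength, Set.not_nonempty_iff_eq_empty.1 h, finsum_mem_empty]

variable {T}

lemma commonLength_nonneg {ℓ : Sym2 T.V → ℝ} (hℓ : ∀ e ∈ T.internalEdges, 0 ≤ ℓ e)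
    (v : T.V) (i j : Fin n) : 0 ≤ T.commonLength ℓ v i j := by
  classical
  have := T.finite
  have := Fintype.ofFinite T.internalEdges
  rw [commonLength_eq_sum]
  refine Finset.sum_nonneg fun e he => ?_
  split_ifs
  · exact hℓ e (by simpa using he)
  · exact le_rfl

lemma commonLength_pos {ℓ : Sym2 T.V → ℝ} (hℓ : ∀ e ∈ T.internalEdges, 0 < ℓ e)
    {v : T.V} {i j : Fin n} (h : T.Shares v i j) : 0 < T.commonLength ℓ v i j := by
  classical
  have := T.finite
  have := Fintype.ofFinite T.internalEdges
  rw [commonLength_eq_sum]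
  obtain ⟨e, ⟨he, h1⟩, h2⟩ := h
  refine Finset.sum_pos' (fun e he => ?_) ⟨e, by simpa using he, ?_⟩
  · split_ifs
    · exact (hℓ e (by simpa using he)).le
    · exact le_rfl
  · rw [if_pos ⟨h1, h2⟩]
    exact hℓ e he

/-- A change of the origin only scales rows and columns. -/
lemma exists_scaling (ℓ : Sym2 T.V → ℝ) (O O' : T.V) : ∃ r c : Fin n → ℝ, ∀ i j,
    T.commonLength ℓ O i j = T.commonLength ℓ O' i j + r i + c j := by
  classical
  have := T.finite
  have := Fintype.ofFinite T.internalEdges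
  -- Let `p` and `q` be 1 or 0 as an edge between `O` and `O'` is or is not on the path from `O'` to
  -- the first and second leaf. Seen from `O` these become `1 - p` and `1 - q`, and `(1 - p) * (1 -
  -- q) - p * q = (1/2 - p) + (1/2 - q)`.
  let f : Fin n ⊕ Fin n → ℝ := fun a => ∑ e ∈ T.internalEdges.toFinset,
    if e ∈ T.graph.pathEdges O O' then
      (if e ∈ T.graph.pathEdges O' (T.leaf a) then - ℓ e / 2 else ℓ e / 2) else 0
  refine ⟨fun i => f (Sum.inl i), fun j => f (Sum.inr j), fun i j => ?_⟩
  simp only [f, commonLength_eq_sum, ← Finset.sum_add_distrib]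
  refine Finset.sum_congr rfl fun e _ => ?_
  change (if e ∈ T.graph.pathEdges O _ ∧ e ∈ T.graph.pathEdges O _ then _ else _) =
    (if e ∈ T.graph.pathEdges O' _ ∧ e ∈ T.graph.pathEdges O' _ then _ else _) + _ + _
  rw [T.isTree.mem_pathEdges_iff_xor O O' (T.leaf (Sum.inl i)),
    T.isTree.mem_pathEdges_iff_xor O O' (T.leaf (Sum.inr j))]
  by_cases h1 : e ∈ T.graph.pathEdges O O' <;>
    by_cases h2 : e ∈ T.graph.pathEdges O' (T.leaf (Sum.inl i)) <;>
    by_cases h3 : e ∈ T.graph.pathEdges O' (T.leaf (Sum.inr j)) <;>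
    simp [h1, h2, h3] <;> ring

lemma IsMatrixOf.exists_eq {ℓ : Sym2 T.V → ℝ} {x : SymMat n} (h : T.IsMatrixOf ℓ x) (v : T.V) :
    ∃ r c : Fin n → ℝ, ∀ i j, x s(i, j) = T.commonLength ℓ v i j + r i + c j := by
  obtain ⟨O, r, c, hx⟩ := h
  obtain ⟨r', c', h'⟩ := exists_scaling ℓ O v
  refine ⟨fun i => r' i + r i, fun j => c' j + c j, fun i j => ?_⟩
  rw [hx, h']
  ring

/-- The terms of a minor that attain the minimum, in terms of a vertex of the tree. -/
lemma IsMatrixOf.minorExponent_mem {ℓ : Sym2 T.V → ℝ} {x : SymMat n} (h : T.IsMatrixOf ℓ x)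
    (hℓ : ∀ e ∈ T.internalEdges, 0 ≤ ℓ e) {v : T.V} {I J : Fin 3 ↪o Fin n}
    {σ : Equiv.Perm (Fin 3)} (hσ : ∀ a, ¬ T.Shares v (I (σ a)) (J a)) :
    minorExponent I J σ ∈ minMonomials (symMinor I J) x := by
  obtain ⟨r, c, hx⟩ := h.exists_eq v
  refine mem_minMonomials_symMinor.2 ⟨σ, rfl, fun τ => ?_⟩
  simp only [hx, Finset.sum_add_distrib]
  rw [Equiv.sum_comp σ (fun a => r (I a)), Equiv.sum_comp τ (fun a => r (I a))]
  have : ∑ a, T.commonLength ℓ v (I (σ a)) (J a) ≤ ∑ a, T.commonLength ℓ v (I (τ a)) (J a) := by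
    refine Finset.sum_le_sum fun a _ => ?_
    rw [T.commonLength_of_not_shares ℓ (hσ a)]
    exact commonLength_nonneg hℓ _ _ _
  linarith

/-- With origin `v` all terms are nonnegative up to a common constant, `σ` attains zero, and by
positivity of `ℓ` the zero terms are those without sharing. The right side does not involve the
lengths. -/
lemma IsMatrixOf.minMonomials_eq {ℓ : Sym2 T.V → ℝ} {x : SymMat n} (h : T.IsMatrixOf ℓ x)
    (hℓ : ∀ e ∈ T.internalEdges, 0 < ℓ e) {v : T.V} {I J : Fin 3 ↪o Fin n}
    {σ : Equiv.Perm (Fin 3)} (hσ : ∀ a, ¬ T.Shares v (I (σ a)) (J a)) :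
    minMonomials (symMinor I J) x =
      {m | ∃ τ, minorExponent I J τ = m ∧ ∀ a, ¬ T.Shares v (I (τ a)) (J a)} := by
  ext m
  constructor
  · intro hm
    obtain ⟨τ, rfl, hτ⟩ := mem_minMonomials_symMinor.1 hm
    refine ⟨τ, rfl, fun b hb => ?_⟩
    have h1 := hτ σ
    obtain ⟨r, c, hx⟩ := h.exists_eq v
    simp only [hx, Finset.sum_add_distrib] at h1
    rw [Equiv.sum_comp σ (fun a => r (I a)), Equiv.sum_comp τ (fun a => r (I a))] at h1
    have h2 : ∑ a, T.commonLength ℓ v (I (σ a)) (J a) = 0 :=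
      Finset.sum_eq_zero fun a _ => T.commonLength_of_not_shares ℓ (hσ a)
    have h3 : 0 < ∑ a, T.commonLength ℓ v (I (τ a)) (J a) :=
      Finset.sum_pos' (fun a _ => commonLength_nonneg (fun e he => (hℓ e he).le) _ _ _)
        ⟨b, Finset.mem_univ _, commonLength_pos hℓ hb⟩
    linarith
  · rintro ⟨τ, rfl, hτ⟩
    exact h.minorExponent_mem (fun e he => (hℓ e he).le) hτ

/-- At a vertex that is not a leaf, the paths to two different leaves share an internal edge once
they share an edge. -/
lemma exists_internal_of_not_disjoint {v : T.V} (hv : v ∉ Set.range T.leaf)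
    {a b : Fin n ⊕ Fin n} (hab : a ≠ b)
    (h : ¬ Disjoint (T.graph.pathEdges v (T.leaf a)) (T.graph.pathEdges v (T.leaf b))) :
    ∃ w, s(v, w) ∈ T.internalEdges ∧ s(v, w) ∈ T.graph.pathEdges v (T.leaf a) ∧
      s(v, w) ∈ T.graph.pathEdges v (T.leaf b) := by
  obtain ⟨e, ha, hb⟩ := Set.not_disjoint_iff.1 h
  obtain ⟨w, hw, h1, h2⟩ := T.isTree.exists_first_edge ha hb
  refine ⟨w, ⟨hw, fun c hc => ?_⟩, h1, h2⟩
  rcases Sym2.mem_iff.1 hc with hc | hc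
  · exact hv ⟨c, hc⟩
  obtain ⟨z, hz⟩ := Set.ncard_eq_one.1 ((T.degree_eq_one_iff w).2 ⟨c, hc⟩)
  have hzv : ∀ y, T.graph.Adj w y → y = v := by
    intro y hy
    have h3 : y ∈ T.graph.neighborSet w := hy
    have h4 : v ∈ T.graph.neighborSet w := hw.symm
    rw [hz] at h3 h4
    exact h3.trans h4.symm
  -- The leaf `w` has no neighbor but `v`, so the edge between them leads to no other leaf.
  have key : ∀ d, s(v, w) ∈ T.graph.pathEdges v (T.leaf d) → d = c := by
    intro d hd
    by_contra hne
    have hwd : w ≠ T.leaf d := by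
      rw [← hc]
      exact fun h => hne (T.leaf_injective h).symm
    obtain ⟨y, hy, hyd⟩ := T.isTree.exists_adj_mem_pathEdges hwd
    obtain rfl := hzv y hy
    rw [T.isTree.mem_pathEdges_iff_xor y w, T.isTree.pathEdges_adj hw, Sym2.eq_swap] at hd
    simp [hyd] at hd
  exact hab ((key a h1).trans (key b h2).symm)

lemma shares_iff_not_disjoint {v : T.V} (hv : v ∉ Set.range T.leaf) {i j : Fin n} :
    T.Shares v i j ↔ ¬ Disjoint (T.graph.pathEdges v (T.leaf (Sum.inl i)))
      (T.graph.pathEdges v (T.leaf (Sum.inr j))) := by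
  constructor
  · rintro ⟨e, ⟨-, h1⟩, h2⟩
    exact Set.not_disjoint_iff.2 ⟨e, h1, h2⟩
  · intro h
    obtain ⟨w, h1, h2, h3⟩ := exists_internal_of_not_disjoint hv (by simp) h
    exact ⟨_, ⟨h1, h2⟩, h3⟩

variable (T) in
/-- For each choice of three rows and three columns there is a vertex of the tree at which no branch
contains more than three of the six leaves. -/
lemma exists_center (I J : Fin 3 ↪o Fin n) : ∃ v, v ∉ Set.range T.leaf ∧
    ∃ σ τ : Equiv.Perm (Fin 3), σ ≠ τ ∧ (∀ a, ¬ T.Shares v (I (σ a)) (J a)) ∧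
      (∀ a, ¬ T.Shares v (I (τ a)) (J a)) ∧
      ((∃ a, σ a = τ a) ∨ ∃ π : Equiv.Perm (Fin 3), (∀ a, T.Shares v (I (π a)) (J a)) ∧
        (∀ a, σ a ≠ π a) ∧ (∀ a, τ a ≠ π a)) := by
  classical
  have := T.finite
  let a : Fin 3 ⊕ Fin 3 → T.V := T.leaf ∘ Sum.map I J
  have ha : Function.Injective a :=
    T.leaf_injective.comp (Sum.map_injective.2 ⟨I.injective, J.injective⟩)
  obtain ⟨v, hv⟩ := T.isTree.exists_median a
  -- A leaf has a single branch, which would contain at least five of the six given leaves.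
  have hvl : v ∉ Set.range T.leaf := by
    intro hl
    obtain ⟨w, hw⟩ := Set.ncard_eq_one.1 ((T.degree_eq_one_iff v).2 hl)
    have hadj : T.graph.Adj v w := by
      have : w ∈ T.graph.neighborSet v := by simp [hw]
      exact this
    have h1 := hv w hadj
    have h2 : {i | a i = v}ᶜ ⊆ {i | s(v, w) ∈ T.graph.pathEdges v (a i)} := by
      intro i hi
      obtain ⟨w', hw', h3⟩ := T.isTree.exists_adj_mem_pathEdges (Ne.symm hi)
      have h4 : w' ∈ T.graph.neighborSet v := hw'
      rw [hw] at h4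
      rw [Set.mem_singleton_iff.1 h4] at h3
      exact h3
    have h3 : {i | a i = v}.ncard ≤ 1 := by
      rw [Set.ncard_le_one]
      intro i hi j hj
      exact ha (hi.trans hj.symm)
    have h4 := Set.ncard_le_ncard h2
    have h5 := Set.ncard_add_ncard_compl {i | a i = v}
    simp at h1 h5
    omega
  refine ⟨v, hvl, ?_⟩
  have hstep : ∀ r, ∃ w, T.graph.Adj v w ∧ s(v, w) ∈ T.graph.pathEdges v (a r) := fun r =>
    T.isTree.exists_adj_mem_pathEdges (fun h => hvl ⟨_, h.symm⟩)
  choose b hb hba using hstep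
  have hbr : ∀ i j, b (Sum.inl i) = b (Sum.inr j) ↔ T.Shares v (I i) (J j) := by
    intro i j
    rw [shares_iff_not_disjoint hvl]
    constructor
    · intro h
      refine Set.not_disjoint_iff.2 ⟨_, hba (Sum.inl i), ?_⟩
      rw [h]
      exact hba (Sum.inr j)
    · intro h
      obtain ⟨e, h1, h2⟩ := Set.not_disjoint_iff.1 h
      obtain ⟨w, -, h3, h4⟩ := T.isTree.exists_first_edge h1 h2
      exact (T.isTree.eq_of_mem_pathEdges (hba (Sum.inl i)) h3).trans
        (T.isTree.eq_of_mem_pathEdges (hba (Sum.inr j)) h4).symm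
  have hcard : ∀ w, {r : Fin 3 ⊕ Fin 3 |
      Sum.elim (fun i => b (Sum.inl i)) (fun j => b (Sum.inr j)) r = w}.ncard ≤ 3 := by
    intro w
    by_cases hw : ∃ r, b r = w
    · obtain ⟨r₀, rfl⟩ := hw
      have h1 := hv (b r₀) (hb r₀)
      have h2 : {r : Fin 3 ⊕ Fin 3 |
          Sum.elim (fun i => b (Sum.inl i)) (fun j => b (Sum.inr j)) r = b r₀} ⊆
          {i | s(v, b r₀) ∈ T.graph.pathEdges v (a i)} := by
        rintro (r | r) hr
        · simp only [Set.mem_ofPred_eq, Sum.elim_inl] at hr ⊢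
          rw [← hr]
          exact hba _
        · simp only [Set.mem_ofPred_eq, Sum.elim_inr] at hr ⊢
          rw [← hr]
          exact hba _
      have h3 := Set.ncard_le_ncard h2
      simp at h1
      omega
    · have : {r : Fin 3 ⊕ Fin 3 |
          Sum.elim (fun i => b (Sum.inl i)) (fun j => b (Sum.inr j)) r = w} = ∅ := by
        ext r
        simp only [Set.mem_ofPred_eq, Set.mem_empty_iff_false, iff_false]
        intro hr
        refine hw ⟨r, ?_⟩
        rcases r with r | r <;> exact hr
      simp [this]
  obtain ⟨σ, τ, hne, h1, h2, h3⟩ := exists_perms_avoiding _ _ hcard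
  simp only [ne_eq, hbr] at h1 h2 h3
  exact ⟨σ, τ, hne, h1, h2, h3⟩

end LabeledTree

/-! ### Matrices of symbic trees have rank two -/

namespace SymbicTree

variable {n : ℕ} {T : SymbicTree n}

/-- This is where the path of fixed points is used: coinciding monomials would give three fixed
neighbors of a fixed vertex. -/
lemma exists_minorExponent_ne (T : SymbicTree n) (I J : Fin 3 ↪o Fin n) :
    ∃ (v : T.V) (σ τ : Equiv.Perm (Fin 3)), minorExponent I J σ ≠ minorExponent I J τ ∧
      (∀ a, ¬ T.Shares v (I (σ a)) (J a)) ∧ (∀ a, ¬ T.Shares v (I (τ a)) (J a)) := by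
  obtain ⟨v, hv, σ, τ, hne, hσ, hτ, h⟩ := T.exists_center I J
  refine ⟨v, σ, τ, fun heq => ?_, hσ, hτ⟩
  rcases h with ⟨a, ha⟩ | ⟨π, hπ, hσπ, hτπ⟩
  · exact ne_of_minorExponent_eq heq hne a ha
  have hIJ := row_eq_column_of_minorExponent_eq heq hne hσπ hτπ
  have hd := ne_of_minorExponent_eq heq hne
  simp only [LabeledTree.shares_iff_not_disjoint hv] at hπ hσ hτ
  -- The three permutations take different values at `b`, and `π a ≠ π b`, so row `π a` is matched
  -- to column `b` by `σ` or `τ`, which avoid common branches.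
  have hdisj : ∀ a b, a ≠ b → Disjoint (T.graph.pathEdges v (T.leaf (Sum.inl (J a))))
      (T.graph.pathEdges v (T.leaf (Sum.inr (J b)))) := by
    intro a b hab
    have hcase : π a = σ b ∨ π a = τ b := by
      have : ∀ x y z w : Fin 3, x ≠ y → x ≠ z → y ≠ z → w ≠ z → w = x ∨ w = y := by decide
      exact this _ _ _ _ (hd b) (hσπ b) (hτπ b) (fun h => hab (π.injective h))
    rw [← hIJ a]
    rcases hcase with h | h
    · rw [h]
      exact not_not.1 (hσ b)
    · rw [h]
      exact not_not.1 (hτ b)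
  have hswap : ∀ a, T.swap (T.leaf (Sum.inl (J a))) = T.leaf (Sum.inr (J a)) :=
    fun a => T.swap_leaf _
  have hsame : ∀ a, ¬ Disjoint (T.graph.pathEdges v (T.leaf (Sum.inl (J a))))
      (T.graph.pathEdges v (T.leaf (Sum.inr (J a)))) := fun a => hIJ a ▸ hπ a
  obtain ⟨hfix, w, hw, hadj, hwfix⟩ := T.isTree.exists_fixed_neighbors T.swap_involutive
    (v := v) (x := fun a => T.leaf (Sum.inl (J a))) (fun a => by simpa only [hswap] using hsame a)
    (fun a b hab => by
      by_contra hc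
      exact T.isTree.not_disjoint_trans hc (hsame b) (hdisj a b hab))
  rcases T.fixed_path with h | ⟨u, u', p, hp, h⟩
  · have : v ∈ {w | T.swap w = w} := hfix
    simp [h] at this
  · refine T.isTree.not_three_neighbors_mem_support hp hw hadj fun a => ?_
    have : w a ∈ {w | T.swap w = w} := hwfix a
    rw [h] at this
    exact this

lemma symTropRankTwo_of_mem_cone {x : SymMat n} (hx : x ∈ T.cone) : SymTropRankTwo x := by
  obtain ⟨ℓ, -, hℓ, hx⟩ := hx
  intro I J
  obtain ⟨v, σ, τ, hne, hσ, hτ⟩ := T.exists_minorExponent_ne I J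
  exact ⟨_, hx.minorExponent_mem hℓ hσ, _, hx.minorExponent_mem hℓ hτ, hne⟩

lemma openCone_subset_cone : T.openCone ⊆ T.cone := by
  rintro x ⟨ℓ, h, hℓ, hx⟩
  exact ⟨ℓ, h, fun e he => (hℓ e he).le, hx⟩

/-- A permutation without sharing at `v` is minimal for all nonnegative lengths, and for positive
ones no others are minimal. -/
lemma cone_subset_minorCone {x : SymMat n} (hx : x ∈ T.openCone) : T.cone ⊆ minorCone x := by
  rintro y ⟨ℓ', -, hℓ', hy⟩ I J
  obtain ⟨ℓ, -, hℓ, hx⟩ := hx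
  obtain ⟨v, σ, -, -, hσ, -⟩ := T.exists_minorExponent_ne I J
  rw [hx.minMonomials_eq hℓ hσ]
  rintro m ⟨τ, rfl, hτ⟩
  exact hy.minorExponent_mem hℓ' hτ

lemma internalEdges_map_swap {e : Sym2 T.V} (he : e ∈ T.internalEdges) :
    e.map T.swap ∈ T.internalEdges := by
  refine ⟨?_, fun a ha => ?_⟩
  · induction e with | _ u v =>
    exact T.swap.map_adj_iff.2 he.1
  · obtain ⟨v, hv, hva⟩ := Sym2.mem_map.1 ha
    refine he.2 a.swap ?_
    have := T.swap_leaf a.swap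
    rw [Sum.swap_swap, ← hva] at this
    rwa [T.swap.injective this]

/-- Half the negated distances, for unit lengths of the internal edges, are a matrix of the tree. -/
lemma openCone_nonempty (T : SymbicTree n) : T.openCone.Nonempty := by
  classical
  have := T.finite
  have := Fintype.ofFinite T.internalEdges
  let S : Fin n ⊕ Fin n → Fin n ⊕ Fin n → Set (Sym2 T.V) := fun a b =>
    T.internalEdges ∩ T.graph.pathEdges (T.leaf a) (T.leaf b)
  have hle : ∀ a b, (S a b).ncard ≤ (S a.swap b.swap).ncard := by
    intro a b
    refine Set.ncard_le_ncard_of_injOn (Sym2.map T.swap) (fun e he => ⟨?_, ?_⟩)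
      (Sym2.map.injective T.swap.injective).injOn (Set.toFinite _)
    · exact internalEdges_map_swap he.1
    · rw [← T.swap_leaf, ← T.swap_leaf]
      exact SimpleGraph.mem_pathEdges_map T.swap he.2
  have hsymm : ∀ i j, (S (Sum.inl i) (Sum.inr j)).ncard = (S (Sum.inl j) (Sum.inr i)).ncard := by
    have key : ∀ i j, (S (Sum.inl i) (Sum.inr j)).ncard ≤ (S (Sum.inl j) (Sum.inr i)).ncard := by
      intro i j
      refine (hle _ _).trans (le_of_eq ?_)
      simp only [S, Sum.swap_inl, Sum.swap_inr]
      rw [SimpleGraph.pathEdges_comm]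
    exact fun i j => (key i j).antisymm (key j i)
  let x : SymMat n := Sym2.lift ⟨fun i j => - ((S (Sum.inl i) (Sum.inr j)).ncard : ℝ) / 2,
    fun i j => by simp only [hsymm i j]⟩
  obtain ⟨O⟩ := T.isTree.connected.nonempty
  let f : Fin n ⊕ Fin n → ℝ := fun a => ∑ e ∈ T.internalEdges.toFinset,
    if e ∈ T.graph.pathEdges O (T.leaf a) then - 1 / 2 else 0
  refine ⟨x, fun _ => 1, fun e _ => rfl, fun e _ => one_pos, O, fun i => f (Sum.inl i),
    fun j => f (Sum.inr j), fun i j => ?_⟩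
  have hx : x s(i, j) = ∑ e ∈ T.internalEdges.toFinset,
      if e ∈ T.graph.pathEdges (T.leaf (Sum.inl i)) (T.leaf (Sum.inr j)) then - 1 / 2 else 0 := by
    rw [← Finset.sum_filter, Finset.sum_const, nsmul_eq_mul]
    have : (S (Sum.inl i) (Sum.inr j)).ncard = (T.internalEdges.toFinset.filter fun e =>
        e ∈ T.graph.pathEdges (T.leaf (Sum.inl i)) (T.leaf (Sum.inr j))).card := by
      rw [← Set.ncard_coe_finset]
      congr 1
      ext e
      simp [S]
    rw [← this]
    change - ((S (Sum.inl i) (Sum.inr j)).ncard : ℝ) / 2 = _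
    ring
  rw [hx, LabeledTree.commonLength_eq_sum]
  simp only [f, ← Finset.sum_add_distrib]
  refine Finset.sum_congr rfl fun e _ => ?_
  change _ = (if e ∈ T.graph.pathEdges O _ ∧ e ∈ T.graph.pathEdges O _ then _ else _) + _ + _
  rw [T.isTree.mem_pathEdges_iff_xor _ O, SimpleGraph.pathEdges_comm _ O]
  by_cases h2 : e ∈ T.graph.pathEdges O (T.leaf (Sum.inl i)) <;>
    by_cases h3 : e ∈ T.graph.pathEdges O (T.leaf (Sum.inr j)) <;>
    simp [h2, h3]; norm_num

lemma SameType.isMatrixOf {T' : SymbicTree n} {φ : T.graph ≃g T'.graph}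
    (hφ : ∀ a, φ (T.leaf a) = T'.leaf a) {ℓ : Sym2 T'.V → ℝ} {y : SymMat n}
    (hy : T'.IsMatrixOf ℓ y) : T.IsMatrixOf (fun e => ℓ (e.map φ)) y := by
  obtain ⟨O, r, c, hy⟩ := hy
  refine ⟨φ.symm O, r, c, fun i j => ?_⟩
  rw [hy, LabeledTree.commonLength, LabeledTree.commonLength]
  congr 2
  have hset : T'.internalEdges ∩ T'.pathEdges O (T'.leaf (Sum.inl i)) ∩
      T'.pathEdges O (T'.leaf (Sum.inr j)) =
      Sym2.map φ '' (T.internalEdges ∩ T.pathEdges (φ.symm O) (T.leaf (Sum.inl i)) ∩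
        T.pathEdges (φ.symm O) (T.leaf (Sum.inr j))) := by
    ext e'
    obtain ⟨e, rfl⟩ : ∃ e, Sym2.map φ e = e' :=
      ⟨Sym2.map φ.symm e', by simp [Sym2.map_map]⟩
    have hpath : ∀ a, e.map φ ∈ T'.pathEdges O (T'.leaf a) ↔
        e ∈ T.pathEdges (φ.symm O) (T.leaf a) := by
      intro a
      have := SimpleGraph.map_mem_pathEdges_iff φ (u := φ.symm O) (v := T.leaf a) (e := e)
      rwa [hφ, RelIso.apply_symm_apply] at this
    have hint : e.map φ ∈ T'.internalEdges ↔ e ∈ T.internalEdges := by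
      refine and_congr ?_ (forall_congr' fun a => not_congr ?_)
      · induction e with | _ u v =>
        exact φ.map_adj_iff
      · rw [← hφ]
        simp [Sym2.mem_map]
    rw [Function.Injective.mem_set_image (Sym2.map.injective φ.injective)]
    simp only [Set.mem_inter_iff, hpath, hint]
  rw [hset, finsum_mem_image (Sym2.map.injective φ.injective).injOn]

lemma SameType.minMonomials_eq {T' : SymbicTree n} (h : T.SameType T') {x y : SymMat n}
    (hx : x ∈ T.openCone) (hy : y ∈ T'.openCone) (I J : Fin 3 ↪o Fin n) :
    minMonomials (symMinor I J) x = minMonomials (symMinor I J) y := by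
  obtain ⟨φ, hφ⟩ := h
  obtain ⟨ℓ, -, hℓ, hx⟩ := hx
  obtain ⟨ℓ', -, hℓ', hy⟩ := hy
  obtain ⟨v, σ, -, -, hσ, -⟩ := T.exists_minorExponent_ne I J
  rw [hx.minMonomials_eq hℓ hσ, (SameType.isMatrixOf hφ hy).minMonomials_eq ?_ hσ]
  intro e he
  refine hℓ' _ ⟨?_, fun a ha => ?_⟩
  · induction e with | _ u v =>
    exact φ.map_adj_iff.2 he.1
  · obtain ⟨v, hv, hva⟩ := Sym2.mem_map.1 ha
    rw [← hφ] at hva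
    exact he.2 a (φ.injective hva ▸ hv)

end SymbicTree

/-! ### Rank two forces the fixed points to form a path -/

namespace LabeledTree

variable {n : ℕ} {T : LabeledTree n}

lemma mem_side_iff {e : Sym2 T.V} {v w : T.V} : w ∈ T.side e v ↔ e ∉ T.graph.pathEdges v w := by
  rw [T.isTree.mem_pathEdges_iff_not_reachable, not_not]
  rfl

/-- If an involution as in a symbic tree has a fixed vertex with three fixed neighbors, then some
principal minor is attained at only one monomial. -/
lemma not_symTropRankTwo_of_fixed (hb : T.IsBicolored) {s : T.graph ≃g T.graph}
    (hsl : ∀ a, s (T.leaf a) = T.leaf a.swap) {ℓ : Sym2 T.V → ℝ} {x : SymMat n}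
    (hx : T.IsMatrixOf ℓ x) (hℓ : ∀ e ∈ T.internalEdges, 0 < ℓ e) {v : T.V} (hv : s v = v)
    {w : Fin 3 → T.V} (hw : Function.Injective w) (hadj : ∀ a, T.graph.Adj v (w a))
    (hfix : ∀ a, s (w a) = w a) : ¬ SymTropRankTwo x := by
  classical
  have hnl : ∀ u, s u = u → ∀ a, T.leaf a ≠ u := by
    rintro u hu a rfl
    rw [hsl] at hu
    have := T.leaf_injective hu
    rcases a with a | a <;> simp at this
  have hint : ∀ a, s(v, w a) ∈ T.internalEdges := by
    refine fun a => ⟨hadj a, fun c hc => ?_⟩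
    rcases Sym2.mem_iff.1 hc with hc | hc
    · exact hnl _ hv _ hc
    · exact hnl _ (hfix a) _ hc
  have hleaf : ∀ a, ∃ i, s(v, w a) ∈ T.graph.pathEdges v (T.leaf (Sum.inl i)) := by
    intro a
    obtain ⟨i, hi⟩ := (hb _ (hint a) (w a) (by simp)).1
    refine ⟨i, ?_⟩
    rw [T.isTree.mem_pathEdges_iff_xor v (w a), T.isTree.pathEdges_adj (hadj a)]
    simpa using mem_side_iff.1 hi
  choose f hf using hleaf
  -- The involution fixes the edge from `v` to `w a`, so the partner leaf is in the same branch.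
  have hf' : ∀ a, s(v, w a) ∈ T.graph.pathEdges v (T.leaf (Sum.inr (f a))) := by
    intro a
    have := SimpleGraph.mem_pathEdges_map s (hf a)
    rwa [hsl, hv, Sym2.map_mk, hv, hfix] at this
  have hfinj : Function.Injective f := fun a b hab =>
    hw (T.isTree.eq_of_mem_pathEdges (hf a) (hab ▸ hf b))
  have hcard : (Finset.univ.image f).card = 3 := by
    rw [Finset.card_image_of_injective _ hfinj, Finset.card_fin]
  let I := (Finset.univ.image f).orderEmbOfFin hcard
  have hg : ∀ a, ∃ b, f b = I a := by
    intro a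
    obtain ⟨b, -, hb⟩ := Finset.mem_image.1 (Finset.orderEmbOfFin_mem _ hcard a)
    exact ⟨b, hb⟩
  choose g hg using hg
  have hginj : Function.Injective g := fun a b hab =>
    I.injective (by rw [← hg a, ← hg b, hab])
  have hshare : ∀ a b, T.Shares v (I a) (I b) ↔ a = b := by
    intro a b
    rw [shares_iff_not_disjoint (by rintro ⟨a, ha⟩; exact hnl v hv a ha), ← hg a, ← hg b]
    constructor
    · intro h
      obtain ⟨e, h1, h2⟩ := Set.not_disjoint_iff.1 h
      obtain ⟨u, -, h3, h4⟩ := T.isTree.exists_first_edge h1 h2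
      exact hginj (hw ((T.isTree.eq_of_mem_pathEdges (hf (g a)) h3).trans
        (T.isTree.eq_of_mem_pathEdges (hf' (g b)) h4).symm))
    · rintro rfl
      exact Set.not_disjoint_iff.2 ⟨_, hf _, hf' _⟩
  intro hrk
  have h := hrk I I
  -- Only partners share, so the minimizing permutations are the two derangements; `finRotate 3` is
  -- one of them.
  rw [hx.minMonomials_eq hℓ (σ := finRotate 3) (v := v)
    (by simp only [hshare]; decide)] at h
  obtain ⟨_, ⟨σ, rfl, hσ⟩, _, ⟨τ, rfl, hτ⟩, hne⟩ := h
  simp only [hshare] at hσ hτ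
  exact hne (minorExponent_eq_of_derangement hσ hτ)

/-- The unique path between two fixed vertices is mapped to itself, hence fixed vertex by vertex;
rank two excludes branching. -/
lemma fixed_path_of_symTropRankTwo (hb : T.IsBicolored) {s : T.graph ≃g T.graph}
    (hsl : ∀ a, s (T.leaf a) = T.leaf a.swap) {ℓ : Sym2 T.V → ℝ} {x : SymMat n}
    (hx : T.IsMatrixOf ℓ x) (hℓ : ∀ e ∈ T.internalEdges, 0 < ℓ e) (hrk : SymTropRankTwo x) :
    {w | s w = w} = ∅ ∨
    ∃ (u v : T.V) (p : T.graph.Walk u v), p.IsPath ∧ {w | s w = w} = {w | w ∈ p.support} := by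
  have := T.finite
  refine (Set.eq_empty_or_nonempty _).imp_right fun hne =>
    T.isTree.exists_isPath_support_eq hne ?_ ?_
  · intro u (hu : s u = u) v (hv : s v = v) p hp z hz
    have h1 : ((p.map s.toHom).copy hu hv).IsPath := by
      simpa using hp.map s.injective
    have h2 := congrArg SimpleGraph.Walk.support ((T.isTree.existsUnique_path u v).unique h1 hp)
    rw [SimpleGraph.Walk.support_copy, SimpleGraph.Walk.support_map] at h2
    exact List.map_inj_left.1 (h2.trans (List.map_id _).symm) z hz
  · intro v hv w hw hadj hfix
    exact not_symTropRankTwo_of_fixed hb hsl hx hℓ hv hw hadj hfix hrk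

end LabeledTree

/-! ### Rooted trees -/

namespace SimpleGraph

variable {V : Type*}

/-- The graph in which each vertex other than the root `ρ` is joined to its parent. -/
def parentGraph (par : V → V) (ρ : V) : SimpleGraph V :=
  SimpleGraph.fromRel fun u v => u ≠ ρ ∧ par u = v

variable {par : V → V} {ρ : V} {h : V → ℕ}

lemma parentGraph_adj_par (hh : ∀ v, v ≠ ρ → h (par v) < h v) {v : V} (hv : v ≠ ρ) :
    (parentGraph par ρ).Adj v (par v) := by
  rw [parentGraph, fromRel_adj]
  refine ⟨fun heq => ?_, Or.inl ⟨hv, rfl⟩⟩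
  have := hh v hv
  rw [← heq] at this
  exact lt_irrefl _ this

/-- Here `le v w` stands for `w` being `v` or an ancestor of `v`. The path to the parent is
prolonged by one edge; the height bound shows that `v` is new. -/
lemma exists_isPath_parentGraph {le : V → V → Prop} (hh : ∀ v, v ≠ ρ → h (par v) < h v)
    (hρ : ∀ w, w ≠ ρ → ¬ le ρ w)
    (hle : ∀ v w, v ≠ ρ → w ≠ ρ → (le v w ↔ v = w ∨ le (par v) w)) (v : V) :
    ∃ p : (parentGraph par ρ).Walk ρ v, p.IsPath ∧ (∀ w ∈ p.support, h w ≤ h v) ∧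
      ∀ e, e ∈ p.edges ↔ ∃ w, w ≠ ρ ∧ le v w ∧ e = s(w, par w) := by
  induction hv : h v using Nat.strong_induction_on generalizing v with | _ k ih =>
  subst hv
  by_cases hvρ : v = ρ
  · subst hvρ
    refine ⟨Walk.nil, Walk.IsPath.nil, by simp, fun e => ?_⟩
    simp only [Walk.edges_nil, List.not_mem_nil, false_iff]
    rintro ⟨w, hw, hw', -⟩
    exact hρ w hw hw'
  · obtain ⟨p, hp, hs, he⟩ := ih _ (hh v hvρ) (par v) rfl
    refine ⟨p.concat (parentGraph_adj_par hh hvρ).symm, ?_, ?_, ?_⟩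
    · rw [Walk.concat_isPath_iff]
      exact ⟨hp, fun hmem => absurd (hs v hmem) (not_le.2 (hh v hvρ))⟩
    · intro w hw
      rw [Walk.support_concat, List.mem_append, List.mem_singleton] at hw
      rcases hw with hw | rfl
      · exact (hs w hw).trans (hh v hvρ).le
      · exact le_rfl
    · intro e
      rw [Walk.edges_concat, List.concat_eq_append, List.mem_append, List.mem_singleton, he]
      constructor
      · rintro (⟨w, hw, hvw, rfl⟩ | rfl)
        · exact ⟨w, hw, (hle v w hvρ hw).2 (Or.inr hvw), rfl⟩
        · exact ⟨v, hvρ, (hle v v hvρ hvρ).2 (Or.inl rfl), Sym2.eq_swap⟩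
      · rintro ⟨w, hw, hvw, rfl⟩
        rcases (hle v w hvρ hw).1 hvw with rfl | hvw
        · exact Or.inr Sym2.eq_swap
        · exact Or.inl ⟨w, hw, hvw, rfl⟩

/-- Climbing to parents ends at the root, and there is at most one edge for each vertex other than
the root. -/
lemma isTree_parentGraph [Finite V] (hh : ∀ v, v ≠ ρ → h (par v) < h v) :
    (parentGraph par ρ).IsTree := by
  classical
  have hconn : (parentGraph par ρ).Connected := by
    have key : ∀ v, (parentGraph par ρ).Reachable v ρ := by
      intro v
      induction hv : h v using Nat.strong_induction_on generalizing v with | _ k ih =>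
      subst hv
      by_cases hvρ : v = ρ
      · rw [hvρ]
      · exact (parentGraph_adj_par hh hvρ).reachable.trans (ih _ (hh v hvρ) (par v) rfl)
    exact (connected_iff _).2 ⟨fun u v => (key u).trans (key v).symm, ⟨ρ⟩⟩
  rw [isTree_iff_connected_and_card]
  refine ⟨hconn, le_antisymm ?_ hconn.card_vert_le_card_edgeSet_add_one⟩
  have hsub : (parentGraph par ρ).edgeSet ⊆ (fun v => s(v, par v)) '' {v | v ≠ ρ} := by
    intro e he
    induction e with | _ u v =>
    rw [mem_edgeSet, parentGraph, fromRel_adj] at he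
    rcases he.2 with ⟨hu, rfl⟩ | ⟨hv, rfl⟩
    · exact ⟨u, hu, rfl⟩
    · exact ⟨v, hv, Sym2.eq_swap⟩
  have h1 := (Set.ncard_le_ncard hsub (Set.toFinite _)).trans (Set.ncard_image_le (Set.toFinite _))
  have h2 : {v | v ≠ ρ}.ncard + 1 = Nat.card V := by
    have := Set.ncard_add_ncard_compl ({ρ} : Set V)
    rw [Set.ncard_singleton] at this
    have h3 : {v | v ≠ ρ} = ({ρ} : Set V)ᶜ := rfl
    rw [h3]
    omega
  rw [Nat.card_coe_set_eq]
  omega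

/-- The sum of the differences of a potential along the ancestors of `v`. -/
lemma finsum_ancestors_sub [Finite V] {le : V → V → Prop}
    (hh : ∀ v, v ≠ ρ → h (par v) < h v) (hρ : ∀ w, w ≠ ρ → ¬ le ρ w)
    (hle : ∀ v w, v ≠ ρ → w ≠ ρ → (le v w ↔ v = w ∨ le (par v) w))
    (hirr : ∀ v, v ≠ ρ → ¬ le (par v) v) (H : V → ℝ) (v : V) :
    ∑ᶠ w ∈ {w | w ≠ ρ ∧ le v w}, (H w - H (par w)) = H v - H ρ := by
  induction hv : h v using Nat.strong_induction_on generalizing v with | _ k ih =>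
  subst hv
  by_cases hvρ : v = ρ
  · subst hvρ
    have : {w | w ≠ v ∧ le v w} = ∅ := by
      ext w
      simp only [Set.mem_ofPred_eq, Set.mem_empty_iff_false, iff_false]
      exact fun hw => hρ w hw.1 hw.2
    rw [this, finsum_mem_empty, sub_self]
  · have : {w | w ≠ ρ ∧ le v w} = insert v {w | w ≠ ρ ∧ le (par v) w} := by
      ext w
      simp only [Set.mem_ofPred_eq, Set.mem_insert_iff]
      by_cases hw : w = ρ
      · subst hw
        simp [Ne.symm hvρ]
      · simp only [hle v w hvρ hw, ne_eq, hw, not_false_eq_true, true_and, eq_comm]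
    rw [this, finsum_mem_insert _ (fun hm => hirr v hvρ hm.2) (Set.toFinite _),
      ih _ (hh v hvρ) (par v) rfl]
    ring

end SimpleGraph

/-! ### Trees from orders -/

section Forest

variable {V : Type*} [PartialOrder V]

/-- The graph of a finite order in which each element is joined to its covers, and any two different
maximal elements are joined. -/
def forestGraph (V : Type*) [PartialOrder V] : SimpleGraph V where
  Adj u v := u ⋖ v ∨ v ⋖ u ∨ (u ≠ v ∧ IsMax u ∧ IsMax v)
  symm := ⟨fun u v h => by
    rcases h with h | h | h
    · exact Or.inr (Or.inl h)
    · exact Or.inl h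
    · exact Or.inr (Or.inr ⟨h.1.symm, h.2.2, h.2.1⟩)⟩
  loopless := ⟨fun u h => by
    rcases h with h | h | h
    · exact h.lt.false
    · exact h.lt.false
    · exact h.1 rfl⟩

open Classical in
/-- The parent of an element: its cover, or the root `ρ` if the element is maximal. -/
noncomputable def forestParent (ρ v : V) : V :=
  if h : ∃ w, v ⋖ w then h.choose else ρ

/-- In an order the elements above a given element form a chain, and there are at most two maximal
elements, one of which is `ρ`. -/
structure IsForestRoot (ρ : V) : Prop where
  chain : ∀ u v w : V, u ≤ v → u ≤ w → v ≤ w ∨ w ≤ v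
  isMax : IsMax ρ
  eq_or_eq : ∀ u v : V, IsMax u → IsMax v → u ≠ v → u = ρ ∨ v = ρ

namespace IsForestRoot

variable {ρ : V}

lemma covBy_unique (hρ : IsForestRoot ρ) {v w w' : V} (h : v ⋖ w) (h' : v ⋖ w') : w = w' := by
  rcases hρ.chain v w w' h.le h'.le with h1 | h1
  · exact h1.eq_of_not_lt (h'.2 h.lt)
  · exact (h1.eq_of_not_lt (h.2 h'.lt)).symm

lemma forestParent_of_covBy (hρ : IsForestRoot ρ) {v w : V} (h : v ⋖ w) :
    forestParent ρ v = w := by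
  have h' : ∃ w, v ⋖ w := ⟨w, h⟩
  rw [forestParent, dif_pos h']
  exact hρ.covBy_unique h'.choose_spec h

lemma forestParent_of_isMax {v : V} (h : IsMax v) : forestParent ρ v = ρ := by
  rw [forestParent, dif_neg]
  rintro ⟨w, hw⟩
  exact h.not_lt hw.lt

lemma exists_covBy [Finite V] {v : V} (h : ¬ IsMax v) : ∃ w, v ⋖ w := by
  obtain ⟨w, hw⟩ := not_isMax_iff.1 h
  obtain ⟨x, hx, -⟩ := exists_covBy_le_of_lt hw
  exact ⟨x, hx⟩

lemma exists_le_isMax [Finite V] (v : V) : ∃ w, v ≤ w ∧ IsMax w := by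
  obtain ⟨w, hw, hmax⟩ := (Set.toFinite (Set.univ : Set V)).exists_le_maximal (Set.mem_univ v)
  exact ⟨w, hw, fun x hx => hmax.2 (Set.mem_univ x) hx⟩

lemma forestGraph_eq [Finite V] (hρ : IsForestRoot ρ) :
    forestGraph V = SimpleGraph.parentGraph (forestParent ρ) ρ := by
  ext u v
  rw [SimpleGraph.parentGraph, SimpleGraph.fromRel_adj]
  have key : ∀ u v : V, u ⋖ v → u ≠ ρ ∧ forestParent ρ u = v := by
    intro u v h
    refine ⟨?_, hρ.forestParent_of_covBy h⟩
    rintro rfl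
    exact hρ.isMax.not_lt h.lt
  have key' : ∀ u v : V, u ≠ ρ ∧ forestParent ρ u = v → (forestGraph V).Adj u v := by
    rintro u v ⟨hu, rfl⟩
    by_cases hm : IsMax u
    · rw [forestParent_of_isMax hm]
      exact Or.inr (Or.inr ⟨hu, hm, hρ.isMax⟩)
    · obtain ⟨w, hw⟩ := exists_covBy hm
      rw [hρ.forestParent_of_covBy hw]
      exact Or.inl hw
  constructor
  · intro h
    refine ⟨h.ne, ?_⟩
    rcases h with h | h | ⟨hne, hu, hv⟩
    · exact Or.inl (key u v h)
    · exact Or.inr (key v u h)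
    · rcases hρ.eq_or_eq u v hu hv hne with rfl | rfl
      · exact Or.inr ⟨hne.symm, forestParent_of_isMax hv⟩
      · exact Or.inl ⟨hne, forestParent_of_isMax hu⟩
  · rintro ⟨-, h | h⟩
    · exact key' u v h
    · exact (key' v u h).symm

open Classical in
/-- The number of steps to the root. -/
noncomputable def height (ρ v : V) : ℕ := if v = ρ then 0 else (Set.Ioi v).ncard + 1

/-- The summand 1 in `height` is needed for a second maximal element: nothing is above it, but its
parent is `ρ`. -/
lemma height_forestParent_lt [Finite V] (hρ : IsForestRoot ρ) (v : V) (hv : v ≠ ρ) :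
    height ρ (forestParent ρ v) < height ρ v := by
  by_cases hm : IsMax v
  · simp [forestParent_of_isMax hm, height, hv]
  · obtain ⟨w, hw⟩ := exists_covBy hm
    rw [hρ.forestParent_of_covBy hw, height, height, if_neg hv]
    split_ifs
    · omega
    · have : (Set.Ioi w).ncard < (Set.Ioi v).ncard :=
        Set.ncard_lt_ncard ⟨Set.Ioi_subset_Ioi hw.le, fun h => (h hw.lt).false⟩ (Set.toFinite _)
      omega

lemma not_le (hρ : IsForestRoot ρ) (w : V) (hw : w ≠ ρ) : ¬ ρ ≤ w :=
  fun h => hw (hρ.isMax.eq_of_le h).symm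

lemma le_iff [Finite V] (hρ : IsForestRoot ρ) (v w : V) (_ : v ≠ ρ) (hw : w ≠ ρ) :
    v ≤ w ↔ v = w ∨ forestParent ρ v ≤ w := by
  by_cases hm : IsMax v
  · rw [forestParent_of_isMax hm]
    simp only [hρ.not_le w hw, or_false]
    exact ⟨fun h => hm.eq_of_le h, fun h => h.le⟩
  · obtain ⟨x, hx⟩ := exists_covBy hm
    rw [hρ.forestParent_of_covBy hx]
    constructor
    · intro h
      rcases h.eq_or_lt with h | h
      · exact Or.inl h
      · refine Or.inr ?_
        rcases hρ.chain v w x h.le hx.le with h1 | h1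
        · exact (h1.eq_of_not_lt (hx.2 h)).ge
        · exact h1
    · rintro (rfl | h)
      · exact le_rfl
      · exact hx.le.trans h

lemma not_forestParent_le [Finite V] (hρ : IsForestRoot ρ) (v : V) (hv : v ≠ ρ) :
    ¬ forestParent ρ v ≤ v := by
  by_cases hm : IsMax v
  · rw [forestParent_of_isMax hm]
    exact hρ.not_le v hv
  · obtain ⟨x, hx⟩ := exists_covBy hm
    rw [hρ.forestParent_of_covBy hx]
    exact hx.lt.not_ge

lemma isTree [Finite V] (hρ : IsForestRoot ρ) : (forestGraph V).IsTree := by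
  rw [hρ.forestGraph_eq]
  exact SimpleGraph.isTree_parentGraph hρ.height_forestParent_lt

lemma mem_edgeSet_iff [Finite V] (hρ : IsForestRoot ρ) {e : Sym2 V} :
    e ∈ (forestGraph V).edgeSet ↔ ∃ w, w ≠ ρ ∧ e = s(w, forestParent ρ w) := by
  rw [hρ.forestGraph_eq]
  constructor
  · intro h
    induction e with | _ u v =>
    rw [SimpleGraph.mem_edgeSet, SimpleGraph.parentGraph, SimpleGraph.fromRel_adj] at h
    rcases h.2 with ⟨hu, rfl⟩ | ⟨hv, rfl⟩
    · exact ⟨u, hu, rfl⟩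
    · exact ⟨v, hv, Sym2.eq_swap⟩
  · rintro ⟨w, hw, rfl⟩
    exact SimpleGraph.parentGraph_adj_par hρ.height_forestParent_lt hw

lemma edge_injOn [Finite V] (hρ : IsForestRoot ρ) :
    Set.InjOn (fun w => s(w, forestParent ρ w)) {w | w ≠ ρ} := by
  intro w hw w' hw' h
  rcases Sym2.eq_iff.1 h with h | h
  · exact h.1
  · have h1 := hρ.height_forestParent_lt w hw
    have h2 := hρ.height_forestParent_lt w' hw'
    rw [h.2] at h1
    rw [← h.1] at h2
    omega

lemma mem_pathEdges_iff [Finite V] (hρ : IsForestRoot ρ) {v : V} {e : Sym2 V} :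
    e ∈ (forestGraph V).pathEdges ρ v ↔ ∃ w, w ≠ ρ ∧ v ≤ w ∧ e = s(w, forestParent ρ w) := by
  have hT := hρ.isTree
  rw [hρ.forestGraph_eq] at hT ⊢
  obtain ⟨p, hp, -, he⟩ := SimpleGraph.exists_isPath_parentGraph hρ.height_forestParent_lt
    hρ.not_le hρ.le_iff v
  rw [hT.mem_pathEdges_of_isPath hp, he]

lemma edge_mem_pathEdges_iff [Finite V] (hρ : IsForestRoot ρ) {v w : V} (hw : w ≠ ρ) :
    s(w, forestParent ρ w) ∈ (forestGraph V).pathEdges ρ v ↔ v ≤ w := by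
  rw [hρ.mem_pathEdges_iff]
  constructor
  · rintro ⟨w', hw', h, he⟩
    rwa [hρ.edge_injOn hw hw' he]
  · intro h
    exact ⟨w, hw, h, rfl⟩

lemma finsum_ancestors_sub [Finite V] (hρ : IsForestRoot ρ) (H : V → ℝ) (v : V) :
    ∑ᶠ w ∈ {w | w ≠ ρ ∧ v ≤ w}, (H w - H (forestParent ρ w)) = H v - H ρ :=
  SimpleGraph.finsum_ancestors_sub hρ.height_forestParent_lt hρ.not_le hρ.le_iff
    hρ.not_forestParent_le H v

/-- A minimal element has at most one neighbor. -/
lemma eq_of_adj_of_isMin (hρ : IsForestRoot ρ) {u v w : V} (hu : IsMin u)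
    (hv : (forestGraph V).Adj u v) (hw : (forestGraph V).Adj u w) : v = w := by
  rcases hv with hv | hv | hv
  · rcases hw with hw | hw | hw
    · exact hρ.covBy_unique hv hw
    · exact absurd hw.lt hu.not_lt
    · exact absurd hv.lt hw.2.1.not_lt
  · exact absurd hv.lt hu.not_lt
  · rcases hw with hw | hw | hw
    · exact absurd hw.lt hv.2.1.not_lt
    · exact absurd hw.lt hu.not_lt
    -- If `u` is also maximal, then `u`, `v`, `w` would be three different maximal elements.
    · by_contra hvw
      have h1 := hρ.eq_or_eq u v hv.2.1 hv.2.2 hv.1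
      have h2 := hρ.eq_or_eq u w hw.2.1 hw.2.2 hw.1
      have h3 := hρ.eq_or_eq v w hv.2.2 hw.2.2 hvw
      have h4 := hv.1
      have h5 := hw.1
      rcases h1 with rfl | rfl <;> rcases h2 with h2 | h2 <;> rcases h3 with h3 | h3 <;>
        simp_all

end IsForestRoot

/-- An automorphism of the order is an automorphism of the tree. -/
def forestGraphIso (s : V ≃o V) : forestGraph V ≃g forestGraph V where
  toEquiv := s.toEquiv
  map_rel_iff' {u v} := by
    simp [forestGraph, OrderIso.isMax_apply]

end Forest

/-! ### Ultrametric similarities of rank two matrices -/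

section RankTwo

variable {n : ℕ}

/-- The condition on the minors, for rows and columns in any order. -/
lemma SymTropRankTwo.exists_le {x : SymMat n} (hx : SymTropRankTwo x) {f g : Fin 3 → Fin n}
    (hf : Function.Injective f) (hg : Function.Injective g) (σ₀ : Equiv.Perm (Fin 3)) :
    ∃ σ, σ ≠ σ₀ ∧ ∑ a, x s(f (σ a), g a) ≤ ∑ a, x s(f (σ₀ a), g a) := by
  classical
  have key : ∀ f : Fin 3 → Fin n, Function.Injective f →
      ∃ (I : Fin 3 ↪o Fin n) (ρ : Equiv.Perm (Fin 3)), ∀ a, f a = I (ρ a) := by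
    intro f hf
    have hcard : (Finset.univ.image f).card = 3 := by
      rw [Finset.card_image_of_injective _ hf, Finset.card_fin]
    let I := (Finset.univ.image f).orderEmbOfFin hcard
    have h : ∀ a, ∃ b, I b = f a := by
      intro a
      have : f a ∈ Set.range I := by
        rw [Finset.range_orderEmbOfFin]
        simp
      exact this
    choose ρ hρ using h
    have hinj : Function.Injective ρ := fun a b hab => hf (by rw [← hρ a, ← hρ b, hab])
    exact ⟨I, Equiv.ofBijective ρ (Finite.injective_iff_bijective.1 hinj), fun a => (hρ a).symm⟩
  obtain ⟨I, ρ, hI⟩ := key f hf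
  obtain ⟨J, ρ', hJ⟩ := key g hg
  have hsum : ∀ σ : Equiv.Perm (Fin 3), ∑ a, x s(f (σ a), g a) =
      ∑ b, x s(I ((ρ * σ * ρ'⁻¹) b), J b) := by
    intro σ
    refine Eq.trans ?_ (Equiv.sum_comp ρ' _)
    refine Finset.sum_congr rfl fun a _ => ?_
    simp [hI, hJ]
  obtain ⟨m, hm, m', hm', hne⟩ := hx I J
  obtain ⟨τ, rfl, hτ⟩ := mem_minMonomials_symMinor.1 hm
  obtain ⟨τ', rfl, hτ'⟩ := mem_minMonomials_symMinor.1 hm'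
  have hback : ∀ τ : Equiv.Perm (Fin 3), ρ * (ρ⁻¹ * τ * ρ') * ρ'⁻¹ = τ := by
    intro τ
    group
  by_cases h : ρ⁻¹ * τ * ρ' = σ₀
  · refine ⟨ρ⁻¹ * τ' * ρ', ?_, ?_⟩
    · rintro h'
      refine hne ?_
      rw [← hback τ, ← hback τ', h, h']
    · rw [hsum, hsum, hback]
      exact hτ' _
  · refine ⟨ρ⁻¹ * τ * ρ', h, ?_⟩
    rw [hsum, hsum, hback]
    exact hτ _

/-- The maximal vectors below a symmetric matrix: every row has an equality. -/
lemma exists_tight (a : Fin n → Fin n → ℝ) (ha : ∀ i j, a i j = a j i) :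
    ∃ r : Fin n → ℝ, (∀ i j, r i + r j ≤ a i j) ∧ ∀ i, ∃ j, r i + r j = a i j := by
  classical
  have key : ∀ s : Finset (Fin n), ∃ r : Fin n → ℝ, (∀ i j, r i + r j ≤ a i j) ∧
      ∀ i ∈ s, ∃ j, r i + r j = a i j := by
    intro s
    induction s using Finset.induction_on with
    | empty =>
      obtain ⟨m, hm⟩ : ∃ m : ℝ, ∀ q : Fin n × Fin n, m ≤ a q.1 q.2 := by
        obtain ⟨m, hm⟩ := (Set.finite_range fun q : Fin n × Fin n => a q.1 q.2).bddBelow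
        exact ⟨m, fun q => hm ⟨q, rfl⟩⟩
      exact ⟨fun _ => m / 2, fun i j => by simpa using hm (i, j), by simp⟩
    | insert i s hi ih =>
      obtain ⟨r, hr, ht⟩ := ih
      -- The minimum of `g` is the largest value that the constraints on coordinate `i` allow; the
      -- diagonal constraint counts `r i` twice.
      let g : Fin n → ℝ := fun j => if j = i then a i i / 2 else a i j - r j
      obtain ⟨j₀, -, hj₀⟩ := Finset.exists_min_image Finset.univ g ⟨i, Finset.mem_univ i⟩
      have hgi : g i = a i i / 2 := if_pos rfl
      have hgj : ∀ j, j ≠ i → g j = a i j - r j := fun j hj => if_neg hj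
      have hge : r i ≤ g j₀ := by
        by_cases h : j₀ = i
        · rw [h, hgi]
          linarith [hr i i]
        · rw [hgj _ h]
          linarith [hr i j₀]
      have hfeas : ∀ j, j ≠ i → g j₀ + r j ≤ a i j := by
        intro j hj
        have := hj₀ j (Finset.mem_univ _)
        rw [hgj j hj] at this
        linarith
      have hfeas' : g j₀ + g j₀ ≤ a i i := by
        have := hj₀ i (Finset.mem_univ _)
        rw [hgi] at this
        linarith
      have hle : ∀ k l, Function.update r i (g j₀) k + Function.update r i (g j₀) l ≤ a k l := by
        intro k l
        by_cases hk : k = i <;> by_cases hl : l = i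
        · subst hk hl
          simpa using hfeas'
        · subst hk
          simpa [hl] using hfeas l hl
        · subst hl
          simpa [hk, add_comm, ha k l] using hfeas k hk
        · simpa [hk, hl] using hr k l
      refine ⟨Function.update r i (g j₀), hle, fun k hk => ?_⟩
      rcases Finset.mem_insert.1 hk with rfl | hk
      · refine ⟨j₀, ?_⟩
        by_cases h : j₀ = k
        · rw [h, Function.update_self, ← h, h, hgi]
          ring
        · rw [Function.update_self, Function.update_of_ne h, hgj _ h]
          ring
      · obtain ⟨j, hj⟩ := ht k hk
        refine ⟨j, le_antisymm (hle k j) ?_⟩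
        rw [← hj]
        -- Coordinates only grow, so equalities obtained earlier persist.
        have hmono : ∀ l, r l ≤ Function.update r i (g j₀) l := by
          intro l
          by_cases hl : l = i
          · subst hl
            simpa using hge
          · simp [hl]
        exact add_le_add (hmono k) (hmono j)
  obtain ⟨r, hr, ht⟩ := key Finset.univ
  exact ⟨r, hr, fun i => ht i (Finset.mem_univ i)⟩

/-- A matrix of rank two, scaled to be nonnegative with a zero in each row, is a similarity
satisfying a bipartite ultrametric inequality. -/
lemma SymTropRankTwo.min_le {x : SymMat n} (hx : SymTropRankTwo x) {r : Fin n → ℝ}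
    (hr : ∀ i j, r i + r j ≤ x s(i, j)) (ht : ∀ i, ∃ j, r i + r j = x s(i, j)) (i j k l : Fin n) :
    min (x s(i, l) - r i - r l) (min (x s(k, l) - r k - r l) (x s(k, j) - r k - r j)) ≤
      x s(i, j) - r i - r j := by
  by_contra! hc
  obtain ⟨h1, h2, h3⟩ : x s(i, j) - r i - r j < x s(i, l) - r i - r l ∧
      x s(i, j) - r i - r j < x s(k, l) - r k - r l ∧
      x s(i, j) - r i - r j < x s(k, j) - r k - r j := by
    simpa [lt_min_iff] using hc
  -- After scaling, the entries `(p, l)` and `(k, q)` are zero. In the minor with rows `i, k, p` and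
  -- columns `j, l, q`, the term through `(i, j)`, `(p, l)`, `(k, q)` is the scaled entry at `(i,
  -- j)`. Every other term contains one of the larger entries at `(i, l)`, `(k, l)`, `(k, j)`, so
  -- the minimum would be attained only once.
  obtain ⟨p, hp⟩ := ht l
  obtain ⟨q, hq⟩ := ht k
  have h0 := hr i j
  rw [Sym2.eq_swap] at hp
  have hik : i ≠ k := by rintro rfl; exact lt_irrefl _ h3
  have hjl : j ≠ l := by rintro rfl; exact lt_irrefl _ h1
  have hpi : p ≠ i := by rintro rfl; linarith
  have hpk : p ≠ k := by rintro rfl; linarith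
  have hqj : q ≠ j := by rintro rfl; linarith
  have hql : q ≠ l := by rintro rfl; linarith
  obtain ⟨σ, hσ, hle⟩ := hx.exists_le (f := ![i, k, p]) (g := ![j, l, q])
    (by
      intro a b hab
      fin_cases a <;> fin_cases b <;> simp_all)
    (by
      intro a b hab
      fin_cases a <;> fin_cases b <;> simp_all)
    (Equiv.swap 1 2)
  have hcases : ∀ σ : Equiv.Perm (Fin 3), σ ≠ Equiv.swap 1 2 →
      (σ 0 = 0 ∧ σ 1 = 1 ∧ σ 2 = 2) ∨ (σ 0 = 1 ∧ σ 1 = 0 ∧ σ 2 = 2) ∨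
      (σ 0 = 1 ∧ σ 1 = 2 ∧ σ 2 = 0) ∨ (σ 0 = 2 ∧ σ 1 = 0 ∧ σ 2 = 1) ∨
      (σ 0 = 2 ∧ σ 1 = 1 ∧ σ 2 = 0) := by decide
  have e0 : (Equiv.swap (1 : Fin 3) 2) 0 = 0 := by decide
  have e1 : (Equiv.swap (1 : Fin 3) 2) 1 = 2 := by decide
  have e2 : (Equiv.swap (1 : Fin 3) 2) 2 = 1 := by decide
  simp only [Fin.sum_univ_three, e0, e1, e2, Matrix.cons_val_zero, Matrix.cons_val_one,
    Matrix.cons_val] at hle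
  have b1 := hr p q
  have b2 := hr p j
  have b3 := hr i q
  rcases hcases σ hσ with ⟨s0, s1, s2⟩ | ⟨s0, s1, s2⟩ | ⟨s0, s1, s2⟩ | ⟨s0, s1, s2⟩ |
      ⟨s0, s1, s2⟩ <;>
    simp only [s0, s1, s2, Matrix.cons_val_zero, Matrix.cons_val_one, Matrix.cons_val] at hle <;>
    linarith

end RankTwo

/-- An ultrametric similarity on the labels which is invariant under the exchange of the colors. -/
structure ColorSimilarity (n : ℕ) where
  sim : Fin n ⊕ Fin n → Fin n ⊕ Fin n → ℝ
  comm : ∀ a b, sim a b = sim b a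
  min_le : ∀ a b c, min (sim a b) (sim b c) ≤ sim a c
  nonneg : ∀ a b, 0 ≤ sim a b
  swap : ∀ a b, sim a.swap b.swap = sim a b
  exists_ge : ∀ a b, ∃ c : Fin n ⊕ Fin n, c.isLeft ≠ a.isLeft ∧ sim a b ≤ sim a c
  exists_zero : ∀ a, ∃ c : Fin n ⊕ Fin n, c.isLeft ≠ a.isLeft ∧ sim a c = 0

/-- Between labels of one color the similarity is the largest level at which both are similar to a
common label of the other color. Symmetry of the matrix makes this the same function for both
colors. -/
lemma SymTropRankTwo.exists_similarity {n : ℕ} {x : SymMat n} (hx : SymTropRankTwo x) :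
    ∃ (S : ColorSimilarity n) (r : Fin n → ℝ),
      ∀ i j, x s(i, j) = S.sim (Sum.inl i) (Sum.inr j) + r i + r j := by
  obtain ⟨r, hr, ht⟩ := exists_tight (fun i j => x s(i, j)) (fun i j => by rw [Sym2.eq_swap])
  let b : Fin n → Fin n → ℝ := fun i j => x s(i, j) - r i - r j
  have hbc : ∀ i j, b i j = b j i := by
    intro i j
    simp only [b, Sym2.eq_swap (a := i) (b := j)]
    ring
  have hb0 : ∀ i j, 0 ≤ b i j := fun i j => by simp only [b]; linarith [hr i j]
  have hbz : ∀ i, ∃ j, b i j = 0 := by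
    intro i
    obtain ⟨j, hj⟩ := ht i
    exact ⟨j, by simp only [b]; linarith⟩
  have hb : ∀ i j k l, min (b i l) (min (b k l) (b k j)) ≤ b i j := fun i j k l =>
    hx.min_le hr ht i j k l
  have hs : ∀ i k, ∃ j, ∀ l, min (b i l) (b k l) ≤ min (b i j) (b k j) := by
    intro i k
    have : Nonempty (Fin n) := ⟨i⟩
    exact Finite.exists_max fun l => min (b i l) (b k l)
  choose w hw using hs
  let s : Fin n → Fin n → ℝ := fun i k => min (b i (w i k)) (b k (w i k))
  have hsb : ∀ i k l, min (b i l) (b k l) ≤ s i k := hw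
  have hsc : ∀ i k, s i k = s k i := by
    have key : ∀ i k, s i k ≤ s k i := by
      intro i k
      rw [show s i k = min (b k (w i k)) (b i (w i k)) from min_comm _ _]
      exact hsb k i _
    exact fun i k => (key i k).antisymm (key k i)
  have hs1 : ∀ i k m, min (s i m) (b m k) ≤ b i k := by
    intro i k m
    refine le_trans ?_ (hb i k m (w i m))
    rw [← min_assoc]
  have hs2 : ∀ i k m, min (s i m) (s m k) ≤ s i k := by
    intro i k m
    refine le_trans ?_ (hsb i k (w m k))
    refine le_min ((min_le_min_left _ (min_le_left _ _)).trans (hs1 i (w m k) m)) ?_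
    exact (min_le_right _ _).trans (min_le_right _ _)
  refine ⟨{
    sim := fun a c => Sum.elim (fun i => Sum.elim (s i) (b i) c) (fun i => Sum.elim (b i) (s i) c) a
    comm := ?_
    min_le := ?_
    nonneg := ?_
    swap := ?_
    exists_ge := ?_
    exists_zero := ?_ }, r, fun i j => ?_⟩
  · rintro (i | i) (k | k) <;> simp [hbc i k, hsc i k]
  · have h1 : ∀ i k m, min (b i m) (b m k) ≤ s i k := fun i k m => by
      rw [hbc m k]
      exact hsb i k m
    have h2 : ∀ i k m, min (b i m) (s m k) ≤ b i k := fun i k m => by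
      rw [min_comm, hsc, hbc i m, hbc i k]
      exact hs1 k i m
    rintro (i | i) (m | m) (k | k) <;>
      first
        | exact hs2 i k m
        | exact hs1 i k m
        | exact h1 i k m
        | exact h2 i k m
  · rintro (i | i) (k | k) <;>
      first
        | exact hb0 i k
        | exact le_min (hb0 _ _) (hb0 _ _)
  · rintro (i | i) (k | k) <;> rfl
  · rintro (i | i) (k | k)
    · exact ⟨Sum.inr (w i k), by simp, min_le_left _ _⟩
    · exact ⟨Sum.inr k, by simp, le_rfl⟩
    · exact ⟨Sum.inl k, by simp, le_rfl⟩
    · exact ⟨Sum.inl (w i k), by simp, min_le_left _ _⟩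
  · rintro (i | i) <;> obtain ⟨j, hj⟩ := hbz i
    · exact ⟨Sum.inr j, by simp, hj⟩
    · exact ⟨Sum.inl j, by simp, hj⟩
  · simp only [Sum.elim_inl, Sum.elim_inr, b]
    ring

/-! ### The tree of a similarity -/

namespace ColorSimilarity

variable {n : ℕ} (S : ColorSimilarity n)

/-- The labels of similarity at least `t` to `a`. -/
def ball (a : Fin n ⊕ Fin n) (t : ℝ) : Set (Fin n ⊕ Fin n) := {b | t ≤ S.sim a b}

/-- The smallest balls containing two given labels. -/
def IsCluster (C : Set (Fin n ⊕ Fin n)) : Prop := ∃ a c, a ≠ c ∧ C = S.ball a (S.sim a c)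

/-- Singletons are added separately because, by `exists_ge`, every ball around `a` that contains `a`
also contains another label. -/
def IsNode (C : Set (Fin n ⊕ Fin n)) : Prop := (∃ a, C = {a}) ∨ S.IsCluster C

/-- The smallest similarity in a set of labels. -/
noncomputable def depth (C : Set (Fin n ⊕ Fin n)) : ℝ := sInf (Set.image2 S.sim C C)

/-- The maximal nodes among those different from the set of all labels. -/
def maxProper : Set (Set (Fin n ⊕ Fin n)) :=
  {D | S.IsNode D ∧ D ≠ Set.univ ∧ ∀ D', S.IsNode D' → D' ≠ Set.univ → D ⊆ D' → D' = D}

/-- The vertices of the tree: the nodes, except that the set of all labels is left out if it would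
be a vertex of degree two. -/
abbrev Vertex : Type :=
  {C : Set (Fin n ⊕ Fin n) // S.IsNode C ∧ (C = Set.univ → S.maxProper.ncard ≠ 2)}

variable {S}

lemma sim_le_self (a c : Fin n ⊕ Fin n) : S.sim a c ≤ S.sim a a := by
  have := S.min_le a c a
  rwa [S.comm c a, min_self] at this

lemma ball_eq_of_mem {a b : Fin n ⊕ Fin n} {t : ℝ} (h : b ∈ S.ball a t) :
    S.ball b t = S.ball a t := by
  have h : t ≤ S.sim a b := h
  ext c
  constructor
  · intro hc
    exact (le_min h hc).trans (S.min_le a b c)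
  · intro hc
    rw [S.comm] at h
    exact (le_min h hc).trans (S.min_le b a c)

lemma depth_ball (a c : Fin n ⊕ Fin n) : S.depth (S.ball a (S.sim a c)) = S.sim a c := by
  have hleast : IsLeast (Set.image2 S.sim (S.ball a (S.sim a c)) (S.ball a (S.sim a c)))
      (S.sim a c) := by
    refine ⟨⟨a, sim_le_self a c, c, le_refl (S.sim a c), rfl⟩, ?_⟩
    rintro _ ⟨b, hb, d, hd, rfl⟩
    rw [← ball_eq_of_mem hb] at hd
    exact hd
  exact hleast.csInf_eq

namespace IsCluster

variable {C D : Set (Fin n ⊕ Fin n)}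

lemma exists_pair (hC : S.IsCluster C) : ∃ a ∈ C, ∃ c ∈ C, a ≠ c ∧ S.sim a c = S.depth C := by
  obtain ⟨a, c, hac, rfl⟩ := hC
  exact ⟨a, sim_le_self a c, c, le_refl (S.sim a c), hac, (depth_ball a c).symm⟩

lemma eq_ball (hC : S.IsCluster C) {b : Fin n ⊕ Fin n} (hb : b ∈ C) :
    C = S.ball b (S.depth C) := by
  obtain ⟨a, c, hac, rfl⟩ := hC
  rw [depth_ball]
  exact (ball_eq_of_mem hb).symm

lemma depth_le (hC : S.IsCluster C) {b d : Fin n ⊕ Fin n} (hb : b ∈ C) (hd : d ∈ C) :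
    S.depth C ≤ S.sim b d := by
  rw [hC.eq_ball hb] at hd
  exact hd

lemma depth_nonneg (hC : S.IsCluster C) : 0 ≤ S.depth C := by
  obtain ⟨a, -, c, -, -, h⟩ := hC.exists_pair
  rw [← h]
  exact S.nonneg a c

/-- The two labels bound the depth of `D` by that of `C`, and both are balls around `a`. -/
lemma subset_of_mem (hC : S.IsCluster C) (hD : S.IsCluster D) {a c : Fin n ⊕ Fin n} (ha : a ∈ C)
    (haD : a ∈ D) (hcD : c ∈ D) (h : S.sim a c ≤ S.depth C) : C ⊆ D := by
  rw [hC.eq_ball ha, hD.eq_ball haD]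
  intro b hb
  exact ((hD.depth_le haD hcD).trans h).trans hb

lemma depth_anti (hC : S.IsCluster C) (hD : S.IsCluster D) (h : C ⊆ D) :
    S.depth D ≤ S.depth C := by
  obtain ⟨a, ha, c, hc, -, hac⟩ := hC.exists_pair
  rw [← hac]
  exact hD.depth_le (h ha) (h hc)

lemma depth_lt (hC : S.IsCluster C) (hD : S.IsCluster D) (h : C ⊂ D) :
    S.depth D < S.depth C := by
  refine (hC.depth_anti hD h.subset).lt_of_ne fun heq => h.ne ?_
  obtain ⟨a, ha, -⟩ := hC.exists_pair
  rw [hC.eq_ball ha, hD.eq_ball (h.subset ha), heq]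

lemma exists_opposite (hC : S.IsCluster C) :
    ∃ a ∈ C, ∃ c ∈ C, c.isLeft ≠ a.isLeft := by
  obtain ⟨a, ha, c, -, -, hac⟩ := hC.exists_pair
  obtain ⟨d, hd, h⟩ := S.exists_ge a c
  refine ⟨a, ha, d, ?_, hd⟩
  rw [hC.eq_ball ha, ← hac]
  exact h

/-- A label of similarity zero to `a` in `C` would make the depth zero, and the ball would be
everything. -/
lemma exists_notMem (hC : S.IsCluster C) (hu : C ≠ Set.univ) {a : Fin n ⊕ Fin n} (ha : a ∈ C) :
    ∃ c ∉ C, c.isLeft ≠ a.isLeft := by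
  obtain ⟨c, hc, h⟩ := S.exists_zero a
  refine ⟨c, fun hcC => hu ?_, hc⟩
  rw [hC.eq_ball ha]
  have h0 := hC.depth_le ha hcC
  ext b
  simp only [Set.mem_univ, iff_true]
  exact (h0.trans h.le).trans (S.nonneg a b)

end IsCluster

lemma exists_inl_inr {P : Fin n ⊕ Fin n → Prop} {a c : Fin n ⊕ Fin n} (ha : P a) (hc : P c)
    (h : c.isLeft ≠ a.isLeft) : (∃ i, P (Sum.inl i)) ∧ ∃ j, P (Sum.inr j) := by
  rcases a with a | a <;> rcases c with c | c
  · simp at h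
  · exact ⟨⟨a, ha⟩, ⟨c, hc⟩⟩
  · exact ⟨⟨c, hc⟩, ⟨a, ha⟩⟩
  · simp at h

lemma IsCluster.bicolored {C : Set (Fin n ⊕ Fin n)} (hC : S.IsCluster C) :
    (∃ i, Sum.inl i ∈ C) ∧ ∃ j, Sum.inr j ∈ C := by
  obtain ⟨a, ha, c, hc, h⟩ := hC.exists_opposite
  exact exists_inl_inr ha hc h

lemma IsCluster.bicolored_compl {C : Set (Fin n ⊕ Fin n)} (hC : S.IsCluster C)
    (hu : C ≠ Set.univ) : (∃ i, Sum.inl i ∉ C) ∧ ∃ j, Sum.inr j ∉ C := by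
  obtain ⟨a, ha, c, hc, h⟩ := hC.exists_opposite
  obtain ⟨b, hb, hba⟩ := hC.exists_notMem hu ha
  obtain ⟨d, hd, hdc⟩ := hC.exists_notMem hu hc
  refine exists_inl_inr (P := fun a => a ∉ C) hb hd ?_
  intro heq
  rw [← heq] at hba
  revert h hba hdc
  cases a.isLeft <;> cases c.isLeft <;> cases d.isLeft <;> simp

lemma IsNode.nonempty {C : Set (Fin n ⊕ Fin n)} (hC : S.IsNode C) : C.Nonempty := by
  rcases hC with ⟨a, rfl⟩ | hC
  · exact Set.singleton_nonempty a
  · obtain ⟨a, ha, -⟩ := hC.exists_pair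
    exact ⟨a, ha⟩

lemma IsNode.isCluster {C : Set (Fin n ⊕ Fin n)} (hC : S.IsNode C) {a c : Fin n ⊕ Fin n}
    (ha : a ∈ C) (hc : c ∈ C) (hac : a ≠ c) : S.IsCluster C := by
  rcases hC with ⟨b, rfl⟩ | hC
  · exact absurd (ha.trans hc.symm) hac
  · exact hC

lemma IsCluster.ne_singleton {C : Set (Fin n ⊕ Fin n)} (hC : S.IsCluster C) (a : Fin n ⊕ Fin n) :
    C ≠ {a} := by
  rintro rfl
  obtain ⟨b, hb, c, hc, hbc, -⟩ := hC.exists_pair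
  exact hbc (hb.trans hc.symm)

/-- Any member of an ultrametric ball is a center, so balls with a common label are concentric. -/
lemma IsNode.subset_or_subset {C D : Set (Fin n ⊕ Fin n)} (hC : S.IsNode C) (hD : S.IsNode D)
    {z : Fin n ⊕ Fin n} (hzC : z ∈ C) (hzD : z ∈ D) : C ⊆ D ∨ D ⊆ C := by
  rcases hC with ⟨a, rfl⟩ | hC
  · obtain rfl : z = a := hzC
    exact Or.inl (Set.singleton_subset_iff.2 hzD)
  rcases hD with ⟨a, rfl⟩ | hD
  · obtain rfl : z = a := hzD
    exact Or.inr (Set.singleton_subset_iff.2 hzC)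
  rw [hC.eq_ball hzC, hD.eq_ball hzD]
  rcases le_total (S.depth C) (S.depth D) with h | h
  · exact Or.inr fun b hb => h.trans hb
  · exact Or.inl fun b hb => h.trans hb

lemma isCluster_univ (a : Fin n ⊕ Fin n) : S.IsCluster Set.univ := by
  obtain ⟨c, hc, h⟩ := S.exists_zero a
  refine ⟨a, c, fun hac => hc (hac ▸ rfl), ?_⟩
  ext b
  simp only [Set.mem_univ, true_iff]
  exact h.le.trans (S.nonneg a b)

lemma depth_univ (a : Fin n ⊕ Fin n) : S.depth Set.univ = 0 := by
  obtain ⟨c, -, h⟩ := S.exists_zero a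
  exact le_antisymm (h ▸ (isCluster_univ a).depth_le (Set.mem_univ a) (Set.mem_univ c))
    (isCluster_univ a).depth_nonneg

lemma singleton_ne_univ (a : Fin n ⊕ Fin n) : ({a} : Set (Fin n ⊕ Fin n)) ≠ Set.univ := by
  intro h
  have : a.swap ∈ ({a} : Set (Fin n ⊕ Fin n)) := h ▸ Set.mem_univ _
  rcases a with a | a <;> simp at this

/-! ### The exchange of the colors -/

lemma IsNode.preimage_swap {C : Set (Fin n ⊕ Fin n)} (hC : S.IsNode C) :
    S.IsNode (Sum.swap ⁻¹' C) := by
  rcases hC with ⟨a, rfl⟩ | ⟨a, c, hac, rfl⟩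
  · refine Or.inl ⟨a.swap, ?_⟩
    ext b
    simp only [Set.mem_preimage, Set.mem_singleton_iff]
    constructor
    · rintro rfl
      rw [Sum.swap_swap]
    · rintro rfl
      rw [Sum.swap_swap]
  · refine Or.inr ⟨a.swap, c.swap, fun h => hac ?_, ?_⟩
    · rw [← Sum.swap_swap a, h, Sum.swap_swap]
    · ext b
      have h := S.swap a b.swap
      rw [Sum.swap_swap] at h
      change S.sim a c ≤ S.sim a b.swap ↔ S.sim a.swap c.swap ≤ S.sim a.swap b
      rw [h, S.swap]

lemma preimage_swap_swap (C : Set (Fin n ⊕ Fin n)) : Sum.swap ⁻¹' (Sum.swap ⁻¹' C) = C := by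
  ext b
  simp

lemma depth_preimage_swap (C : Set (Fin n ⊕ Fin n)) : S.depth (Sum.swap ⁻¹' C) = S.depth C := by
  have key : ∀ C : Set (Fin n ⊕ Fin n), Set.image2 S.sim C C ⊆
      Set.image2 S.sim (Sum.swap ⁻¹' C) (Sum.swap ⁻¹' C) := by
    rintro C _ ⟨a, ha, c, hc, rfl⟩
    exact ⟨a.swap, by simpa using ha, c.swap, by simpa using hc, S.swap a c⟩
  rw [depth, depth]
  congr 1
  refine Set.Subset.antisymm ?_ (key C)
  have := key (Sum.swap ⁻¹' C)
  rwa [preimage_swap_swap] at this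

variable (S) in
/-- The exchange of the colors as an automorphism of the order of the vertices. -/
def vertexSwap : S.Vertex ≃o S.Vertex where
  toFun C := ⟨Sum.swap ⁻¹' C.1, C.2.1.preimage_swap, fun h => C.2.2 (by
    rw [← preimage_swap_swap C.1, h, Set.preimage_univ])⟩
  invFun C := ⟨Sum.swap ⁻¹' C.1, C.2.1.preimage_swap, fun h => C.2.2 (by
    rw [← preimage_swap_swap C.1, h, Set.preimage_univ])⟩
  left_inv C := Subtype.ext (preimage_swap_swap C.1)
  right_inv C := Subtype.ext (preimage_swap_swap C.1)
  map_rel_iff' {C D} := by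
    constructor
    · intro h a ha
      have : a.swap ∈ Sum.swap ⁻¹' C.1 := by simpa using ha
      simpa using h this
    · intro h a ha
      exact h ha

/-! ### The vertices -/

variable (S) in
def leafVertex (a : Fin n ⊕ Fin n) : S.Vertex :=
  ⟨{a}, Or.inl ⟨a, rfl⟩, fun h => absurd h (singleton_ne_univ a)⟩

lemma leafVertex_le {a : Fin n ⊕ Fin n} {C : S.Vertex} : S.leafVertex a ≤ C ↔ a ∈ C.1 :=
  Set.singleton_subset_iff

lemma isCluster_of_ne_leafVertex {C : S.Vertex} (h : ∀ a, S.leafVertex a ≠ C) :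
    S.IsCluster C.1 := by
  rcases C.2.1 with ⟨a, ha⟩ | hC
  · exact absurd (Subtype.ext ha.symm) (h a)
  · exact hC

lemma leafVertex_injective : Function.Injective S.leafVertex := fun _ _ h =>
  Set.singleton_injective (congrArg Subtype.val h)

lemma isMin_leafVertex (a : Fin n ⊕ Fin n) : IsMin (S.leafVertex a) := by
  intro C hC
  obtain ⟨c, hc⟩ := C.2.1.nonempty
  obtain rfl : c = a := hC hc
  exact leafVertex_le.2 hc

lemma mem_maxProper_of_isMax {C : S.Vertex} (h : IsMax C) (hC : C.1 ≠ Set.univ) :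
    C.1 ∈ S.maxProper := by
  refine ⟨C.2.1, hC, fun D hD hD' hCD => ?_⟩
  exact Set.Subset.antisymm (h (b := ⟨D, hD, fun h' => absurd h' hD'⟩) hCD) hCD

lemma maxProper_ncard_of_isMax {C : S.Vertex} (h : IsMax C) (hC : C.1 ≠ Set.univ) :
    S.maxProper.ncard = 2 := by
  obtain ⟨a, ha⟩ := C.2.1.nonempty
  by_contra hne
  exact hC (Set.eq_univ_of_univ_subset
    (h (b := ⟨Set.univ, Or.inr (isCluster_univ a), fun _ => hne⟩) (Set.subset_univ _)))

/-- If the set of all labels is a vertex, it is the only maximal one; otherwise the maximal vertices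
are among the two members of `maxProper`. -/
lemma isForestRoot {ρ : S.Vertex} (hρ : IsMax ρ) : IsForestRoot ρ where
  chain u v w huv huw := by
    obtain ⟨a, ha⟩ := u.2.1.nonempty
    exact v.2.1.subset_or_subset w.2.1 (huv ha) (huw ha)
  isMax := hρ
  eq_or_eq u v hu hv huv := by
    have huniv : ∀ u v : S.Vertex, IsMax v → u.1 = Set.univ → v = u := fun u v hv hu =>
      hv.eq_of_le (show v.1 ⊆ u.1 from fun a _ => hu.symm ▸ Set.mem_univ a)
    by_cases h1 : u.1 = Set.univ
    · exact absurd (huniv u v hv h1).symm huv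
    by_cases h2 : v.1 = Set.univ
    · exact absurd (huniv v u hu h2) huv
    by_cases h3 : ρ.1 = Set.univ
    · exact Or.inl (huniv ρ u hu h3)
    obtain ⟨P, Q, -, hPQ⟩ := Set.ncard_eq_two.1 (maxProper_ncard_of_isMax hu h1)
    have m1 := hPQ.subset (mem_maxProper_of_isMax hu h1)
    have m2 := hPQ.subset (mem_maxProper_of_isMax hv h2)
    have m3 := hPQ.subset (mem_maxProper_of_isMax hρ h3)
    have huv' : u.1 ≠ v.1 := fun h => huv (Subtype.ext h)
    rcases m1 with m1 | m1 <;> rcases m2 with m2 | m2 <;> rcases m3 with m3 | m3 <;>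
      first
        | exact absurd (m1.trans m2.symm) huv'
        | exact Or.inl (Subtype.ext (m1.trans m3.symm))
        | exact Or.inr (Subtype.ext (m2.trans m3.symm))

lemma exists_isMax_mem (a : Fin n ⊕ Fin n) : ∃ C : S.Vertex, IsMax C ∧ a ∈ C.1 := by
  obtain ⟨C, hC, hmax⟩ := IsForestRoot.exists_le_isMax (S.leafVertex a)
  exact ⟨C, hmax, leafVertex_le.1 hC⟩

lemma exists_covBy_mem {u : S.Vertex} (hu : S.IsCluster u.1) {a : Fin n ⊕ Fin n} (ha : a ∈ u.1) :
    ∃ D, D ⋖ u ∧ a ∈ D.1 := by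
  have hlt : S.leafVertex a < u :=
    lt_of_le_of_ne (leafVertex_le.2 ha) fun h => hu.ne_singleton a (congrArg Subtype.val h).symm
  obtain ⟨D, hD, hDu⟩ := exists_le_covBy_of_lt hlt
  exact ⟨D, hDu, leafVertex_le.1 hD⟩

lemma covBy_iff_mem_maxProper {u D : S.Vertex} (hu : u.1 = Set.univ) :
    D ⋖ u ↔ D.1 ∈ S.maxProper := by
  have hlt : ∀ D : S.Vertex, D.1 ≠ Set.univ → D < u := fun D hD =>
    lt_of_le_of_ne (show D.1 ⊆ u.1 from fun a _ => hu.symm ▸ Set.mem_univ a) fun h => hD (h ▸ hu)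
  constructor
  · intro h
    refine ⟨D.2.1, fun h' => h.lt.ne (Subtype.ext (h'.trans hu.symm)), fun D' hD' hne hsub => ?_⟩
    by_contra hDD
    let E : S.Vertex := ⟨D', hD', fun h' => absurd h' hne⟩
    have hDE : D ≤ E := hsub
    exact h.2 (hDE.lt_of_ne fun h' => hDD (congrArg Subtype.val h').symm) (hlt E hne)
  · rintro ⟨-, hne, h⟩
    refine ⟨hlt D hne, fun E hDE hEu => hDE.ne (Subtype.ext (h E.1 E.2.1 ?_ hDE.le).symm)⟩
    exact fun h' => hEu.ne (Subtype.ext (h'.trans hu.symm))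

/-- Two labels realizing the depth of `u` lie in no smaller node, which gives two children. The
third neighbor is the parent, or the other maximal vertex, or a third child if `u` is everything,
since that set is a vertex only when `maxProper` does not have two members. -/
lemma three_le_ncard_neighborSet {u : S.Vertex} (hu : S.IsCluster u.1) :
    3 ≤ ((forestGraph S.Vertex).neighborSet u).ncard := by
  obtain ⟨a, ha, c, hc, hac, hd⟩ := hu.exists_pair
  obtain ⟨A, hA, haA⟩ := exists_covBy_mem hu ha
  obtain ⟨C, hC, hcC⟩ := exists_covBy_mem hu hc
  have hAC : A ≠ C := by
    rintro rfl
    refine hA.lt.not_ge ?_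
    exact hu.subset_of_mem (A.2.1.isCluster haA hcC hac) ha haA hcC hd.le
  obtain ⟨E, hE, hEA, hEC⟩ : ∃ E, (forestGraph S.Vertex).Adj u E ∧ E ≠ A ∧ E ≠ C := by
    by_cases hmax : IsMax u
    · by_cases huniv : u.1 = Set.univ
      · have hne := u.2.2 huniv
        by_contra! hc
        refine hne (Set.ncard_eq_two.2 ⟨A.1, C.1, fun h => hAC (Subtype.ext h), ?_⟩)
        ext D
        constructor
        · intro hD
          let E : S.Vertex := ⟨D, hD.1, fun h => absurd h hD.2.1⟩
          have hE : E ⋖ u := (covBy_iff_mem_maxProper huniv).2 hD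
          by_cases hEA : E = A
          · exact Or.inl (congrArg Subtype.val hEA)
          · exact Or.inr (congrArg Subtype.val (hc E (Or.inr (Or.inl hE)) hEA))
        · rintro (rfl | rfl)
          · exact (covBy_iff_mem_maxProper huniv).1 hA
          · exact (covBy_iff_mem_maxProper huniv).1 hC
      · have h2 := maxProper_ncard_of_isMax hmax huniv
        have hmem := mem_maxProper_of_isMax hmax huniv
        obtain ⟨D, hD, hDu⟩ := Set.exists_ne_of_one_lt_ncard (by omega : 1 < S.maxProper.ncard) u.1
        let E : S.Vertex := ⟨D, hD.1, fun h => absurd h hD.2.1⟩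
        have hE : IsMax E := by
          intro F hEF
          have : F.1 ≠ Set.univ := fun h => F.2.2 h h2
          exact (hD.2.2 F.1 F.2.1 this hEF).subset
        refine ⟨E, Or.inr (Or.inr ⟨fun h => hDu (congrArg Subtype.val h).symm, hmax, hE⟩), ?_, ?_⟩
        · rintro rfl
          exact hE.not_lt hA.lt
        · rintro rfl
          exact hE.not_lt hC.lt
    · obtain ⟨E, hE⟩ := IsForestRoot.exists_covBy hmax
      refine ⟨E, Or.inl hE, ?_, ?_⟩
      · rintro rfl
        exact hE.lt.asymm hA.lt
      · rintro rfl
        exact hE.lt.asymm hC.lt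
  have h3 : ({A, C, E} : Set S.Vertex).ncard = 3 :=
    Set.ncard_eq_three.2 ⟨A, C, E, hAC, hEA.symm, hEC.symm, rfl⟩
  rw [← h3]
  refine Set.ncard_le_ncard ?_ (Set.toFinite _)
  rintro D (rfl | rfl | rfl)
  · exact Or.inr (Or.inl hA)
  · exact Or.inr (Or.inl hC)
  · exact hE

lemma ncard_neighborSet_leafVertex (a : Fin n ⊕ Fin n) :
    ((forestGraph S.Vertex).neighborSet (S.leafVertex a)).ncard = 1 := by
  obtain ⟨ρ, hρ, -⟩ := exists_isMax_mem (S := S) a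
  have hr := isForestRoot hρ
  have hne : S.leafVertex a ≠ S.leafVertex a.swap := by
    intro h
    have := leafVertex_injective h
    rcases a with a | a <;> simp at this
  obtain ⟨w, hw, -⟩ := hr.isTree.exists_adj_mem_pathEdges hne
  refine Set.ncard_eq_one.2 ⟨w, ?_⟩
  ext v
  constructor
  · intro hv
    exact hr.eq_of_adj_of_isMin (isMin_leafVertex a) hv hw
  · rintro rfl
    exact hw

variable (S) in
/-- The tree of a similarity. -/
abbrev labeledTree [NeZero n] : LabeledTree n where
  V := S.Vertex
  finite := inferInstance
  graph := forestGraph S.Vertex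
  isTree := by
    obtain ⟨ρ, hρ, -⟩ := exists_isMax_mem (S := S) (Sum.inl 0)
    exact (isForestRoot hρ).isTree
  leaf := S.leafVertex
  leaf_injective := leafVertex_injective
  degree_eq_one_iff u := by
    constructor
    · intro h
      by_contra hu
      have := three_le_ncard_neighborSet
        (isCluster_of_ne_leafVertex fun a ha => hu ⟨a, ha⟩)
      omega
    · rintro ⟨a, rfl⟩
      exact ncard_neighborSet_leafVertex a
  degree_ne_two u h := by
    by_cases hu : ∃ a, S.leafVertex a = u
    · obtain ⟨a, rfl⟩ := hu
      rw [ncard_neighborSet_leafVertex a] at h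
      omega
    · have := three_le_ncard_neighborSet
        (isCluster_of_ne_leafVertex fun a ha => hu ⟨a, ha⟩)
      omega

end ColorSimilarity

/-! ### Edge lengths and recovery of the similarity -/

namespace ColorSimilarity

variable {n : ℕ} (S : ColorSimilarity n)

open Classical in
/-- The lengths of the edges of the tree. -/
noncomputable def edgeLength : Sym2 S.Vertex → ℝ :=
  Sym2.lift ⟨fun C D => if C ≤ D ∨ D ≤ C then |S.depth C.1 - S.depth D.1|
    else S.depth C.1 + S.depth D.1, fun C D => by
      simp only [or_comm (a := C ≤ D), abs_sub_comm (S.depth C.1), add_comm (S.depth C.1)]⟩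

open Classical in
lemma edgeLength_mk (C D : S.Vertex) : S.edgeLength s(C, D) =
    if C ≤ D ∨ D ≤ C then |S.depth C.1 - S.depth D.1| else S.depth C.1 + S.depth D.1 := rfl

variable {S}

lemma edgeLength_map_swap (e : Sym2 S.Vertex) : S.edgeLength (e.map S.vertexSwap) =
    S.edgeLength e := by
  classical
  induction e with | _ C D =>
  have h : ∀ C, S.depth (S.vertexSwap C).1 = S.depth C.1 := fun C => depth_preimage_swap C.1
  rw [Sym2.map_mk, edgeLength_mk, edgeLength_mk, h, h]
  simp only [map_le_map_iff]

lemma isCluster_of_le {C D : S.Vertex} (hC : S.IsCluster C.1) (h : C ≤ D) : S.IsCluster D.1 := by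
  obtain ⟨a, ha, c, hc, hac, -⟩ := hC.exists_pair
  exact D.2.1.isCluster (h ha) (h hc) hac

section Root

variable {ρ : S.Vertex}

lemma mem_root_of_notMem (hρ : IsMax ρ) {w : S.Vertex} (hw : IsMax w) (hne : w ≠ ρ)
    {a : Fin n ⊕ Fin n} (ha : a ∉ w.1) : a ∈ ρ.1 := by
  obtain ⟨m, hm, ham⟩ := exists_isMax_mem (S := S) a
  have hmw : m ≠ w := fun h => ha (h ▸ ham)
  rcases (isForestRoot hρ).eq_or_eq m w hm hw hmw with rfl | h
  · exact ham
  · exact absurd h hne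

lemma ne_univ_of_ne_root (hρ : IsMax ρ) {w : S.Vertex} (hne : w ≠ ρ) : w.1 ≠ Set.univ :=
  fun h => hne (hρ.eq_of_le (show ρ.1 ⊆ w.1 from fun a _ => h.symm ▸ Set.mem_univ a)).symm

/-- If `w` is maximal, its parent `ρ` contains all labels outside `w`, which include both colors. -/
lemma isCluster_forestParent (hρ : IsMax ρ) {w : S.Vertex} (hne : w ≠ ρ)
    (hw : S.IsCluster w.1) : S.IsCluster (forestParent ρ w).1 := by
  by_cases hm : IsMax w
  · rw [IsForestRoot.forestParent_of_isMax hm]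
    obtain ⟨⟨i, hi⟩, ⟨j, hj⟩⟩ := hw.bicolored_compl (ne_univ_of_ne_root hρ hne)
    exact ρ.2.1.isCluster (mem_root_of_notMem hρ hm hne hi) (mem_root_of_notMem hρ hm hne hj)
      (by simp)
  · obtain ⟨y, hy⟩ := IsForestRoot.exists_covBy hm
    rw [(isForestRoot hρ).forestParent_of_covBy hy]
    exact isCluster_of_le hw hy.le

open Classical in
/-- The signed distance from the root. -/
noncomputable def rootDist (ρ w : S.Vertex) : ℝ :=
  if w ≤ ρ then S.depth w.1 - S.depth ρ.1 else S.depth w.1 + S.depth ρ.1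

/-- An edge between two maximal vertices passes through the omitted set of all labels, of depth
zero; hence its length is the sum of the depths. -/
lemma edgeLength_forestParent (hρ : IsMax ρ) {w : S.Vertex} (hne : w ≠ ρ)
    (hw : S.IsCluster w.1) : S.edgeLength s(w, forestParent ρ w) =
      rootDist ρ w - rootDist ρ (forestParent ρ w) := by
  classical
  have hr := isForestRoot hρ
  by_cases hm : IsMax w
  · have h1 : ¬ w ≤ ρ := fun h => hne (hm.eq_of_le h)
    rw [IsForestRoot.forestParent_of_isMax hm, edgeLength_mk, rootDist, rootDist]
    simp [h1, hr.not_le w hne]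
  · obtain ⟨y, hy⟩ := IsForestRoot.exists_covBy hm
    have hle : w ≤ ρ ↔ y ≤ ρ := by
      refine ⟨fun h => ?_, fun h => hy.le.trans h⟩
      rcases hr.chain w y ρ hy.le h with h1 | h1
      · exact h1
      · exact (hρ.eq_of_le h1).ge
    have hd : S.depth y.1 ≤ S.depth w.1 :=
      hw.depth_anti (isCluster_of_le hw hy.le) hy.le
    rw [hr.forestParent_of_covBy hy, edgeLength_mk, if_pos (Or.inl hy.le),
      abs_of_nonneg (sub_nonneg.2 hd), rootDist, rootDist]
    simp only [hle]
    split_ifs <;> ring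

lemma edgeLength_pos (hρ : IsMax ρ) {w : S.Vertex} (hne : w ≠ ρ) (hw : S.IsCluster w.1) :
    0 < S.edgeLength s(w, forestParent ρ w) := by
  classical
  have hr := isForestRoot hρ
  have hp := isCluster_forestParent hρ hne hw
  obtain ⟨a, ha, -⟩ := hw.exists_pair
  by_cases hm : IsMax w
  · rw [IsForestRoot.forestParent_of_isMax hm] at hp ⊢
    have h1 : ¬ w ≤ ρ := fun h => hne (hm.eq_of_le h)
    rw [edgeLength_mk, if_neg (by simp [h1, hr.not_le w hne])]
    have h2 := hw.depth_lt (isCluster_univ a) (Set.ssubset_univ_iff.2 (ne_univ_of_ne_root hρ hne))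
    rw [depth_univ a] at h2
    have := hp.depth_nonneg
    linarith
  · obtain ⟨y, hy⟩ := IsForestRoot.exists_covBy hm
    rw [hr.forestParent_of_covBy hy] at hp ⊢
    rw [edgeLength_mk, if_pos (Or.inl hy.le), abs_pos, sub_ne_zero]
    exact (hw.depth_lt hp hy.lt).ne'

variable [NeZero n]

lemma mem_internalEdges_iff (hρ : IsMax ρ) {e : Sym2 S.Vertex} :
    e ∈ S.labeledTree.internalEdges ↔
      ∃ w, w ≠ ρ ∧ S.IsCluster w.1 ∧ e = s(w, forestParent ρ w) := by
  constructor
  · rintro ⟨he, hl⟩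
    obtain ⟨w, hw, rfl⟩ := (isForestRoot hρ).mem_edgeSet_iff.1 he
    refine ⟨w, hw, isCluster_of_ne_leafVertex fun a ha => hl a ?_, rfl⟩
    exact Sym2.mem_iff.2 (Or.inl ha)
  · rintro ⟨w, hne, hw, rfl⟩
    refine ⟨(isForestRoot hρ).mem_edgeSet_iff.2 ⟨w, hne, rfl⟩, fun a ha => ?_⟩
    rcases Sym2.mem_iff.1 ha with ha | ha
    · exact hw.ne_singleton a (congrArg Subtype.val ha).symm
    · exact (isCluster_forestParent hρ hne hw).ne_singleton a (congrArg Subtype.val ha).symm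

lemma isBicolored_labeledTree (S : ColorSimilarity n) : S.labeledTree.IsBicolored := by
  obtain ⟨ρ, hρ, -⟩ := exists_isMax_mem (S := S) (Sum.inl 0)
  have hr := isForestRoot hρ
  intro e he v hv
  obtain ⟨w, hne, hw, rfl⟩ := (mem_internalEdges_iff hρ).1 he
  -- Removing the edge above `w` separates the labels in `w` from the others.
  have hside : ∀ a, S.labeledTree.leaf a ∈ S.labeledTree.side s(w, forestParent ρ w) v ↔
      (v ≤ w ↔ a ∈ w.1) := by
    intro a
    rw [LabeledTree.mem_side_iff, S.labeledTree.isTree.mem_pathEdges_iff_xor v ρ,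
      SimpleGraph.pathEdges_comm v ρ, not_not]
    change (s(w, forestParent ρ w) ∈ (forestGraph S.Vertex).pathEdges ρ v ↔
      s(w, forestParent ρ w) ∈ (forestGraph S.Vertex).pathEdges ρ (S.leafVertex a)) ↔ _
    rw [hr.edge_mem_pathEdges_iff hne, hr.edge_mem_pathEdges_iff hne, leafVertex_le]
  simp only [hside]
  rcases Sym2.mem_iff.1 hv with rfl | rfl
  · simpa using hw.bicolored
  · simpa [hr.not_forestParent_le w hne] using hw.bicolored_compl (ne_univ_of_ne_root hρ hne)

lemma commonLength_labeledTree (hρ : IsMax ρ) (i j : Fin n) :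
    S.labeledTree.commonLength S.edgeLength ρ i j =
      ∑ᶠ w ∈ {w | w ≠ ρ ∧ Sum.inl i ∈ w.1 ∧ Sum.inr j ∈ w.1},
        (rootDist ρ w - rootDist ρ (forestParent ρ w)) := by
  have hr := isForestRoot hρ
  have hset : S.labeledTree.internalEdges ∩
      S.labeledTree.pathEdges ρ (S.labeledTree.leaf (Sum.inl i)) ∩
      S.labeledTree.pathEdges ρ (S.labeledTree.leaf (Sum.inr j)) =
      (fun w => s(w, forestParent ρ w)) '' {w | w ≠ ρ ∧ Sum.inl i ∈ w.1 ∧ Sum.inr j ∈ w.1} := by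
    have hpath : ∀ (w : S.Vertex) a, w ≠ ρ → (s(w, forestParent ρ w) ∈
        S.labeledTree.pathEdges ρ (S.labeledTree.leaf a) ↔ a ∈ w.1) := by
      intro w a hne
      rw [← leafVertex_le]
      exact hr.edge_mem_pathEdges_iff hne
    ext e
    constructor
    · rintro ⟨⟨he, hi⟩, hj⟩
      obtain ⟨w, hne, -, rfl⟩ := (mem_internalEdges_iff hρ).1 he
      exact ⟨w, ⟨hne, (hpath w _ hne).1 hi, (hpath w _ hne).1 hj⟩, rfl⟩
    · rintro ⟨w, ⟨hne, hi, hj⟩, rfl⟩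
      exact ⟨⟨(mem_internalEdges_iff hρ).2 ⟨w, hne, w.2.1.isCluster hi hj (by simp), rfl⟩,
        (hpath w _ hne).2 hi⟩, (hpath w _ hne).2 hj⟩
  rw [LabeledTree.commonLength, hset,
    finsum_mem_image (hr.edge_injOn.mono fun w hw => hw.1)]
  refine finsum_mem_congr rfl fun w hw => ?_
  exact edgeLength_forestParent hρ hw.1 (w.2.1.isCluster hw.2.1 hw.2.2 (by simp))

open Classical in
-- The vertices containing both labels are those above the smallest ball `Z` around them, and the
-- sum telescopes to the signed distance of `Z` from the root. If `Z` is the omitted set of all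
-- labels, the sum is empty, exactly one label is in `ρ`, and the corrections cancel.
lemma commonLength_labeledTree_eq (hρ : IsMax ρ) (i j : Fin n) :
    S.labeledTree.commonLength S.edgeLength ρ i j = S.sim (Sum.inl i) (Sum.inr j) +
      (if Sum.inl i ∈ ρ.1 then - S.depth ρ.1 / 2 else S.depth ρ.1 / 2) +
      (if Sum.inr j ∈ ρ.1 then - S.depth ρ.1 / 2 else S.depth ρ.1 / 2) := by
  have hr := isForestRoot hρ
  rw [commonLength_labeledTree hρ]
  let Z := S.ball (Sum.inl i) (S.sim (Sum.inl i) (Sum.inr j))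
  have hZ : S.IsCluster Z := ⟨_, _, by simp, rfl⟩
  have hiZ : Sum.inl i ∈ Z := sim_le_self _ _
  have hjZ : Sum.inr j ∈ Z := le_refl (S.sim (Sum.inl i) (Sum.inr j))
  have hdZ : S.depth Z = S.sim (Sum.inl i) (Sum.inr j) := depth_ball _ _
  have hsub : ∀ w : S.Vertex, Sum.inl i ∈ w.1 ∧ Sum.inr j ∈ w.1 ↔ Z ⊆ w.1 := by
    intro w
    constructor
    · rintro ⟨hi, hj⟩
      exact hZ.subset_of_mem (w.2.1.isCluster hi hj (by simp)) hiZ hi hj hdZ.ge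
    · intro h
      exact ⟨h hiZ, h hjZ⟩
  have hset : {w : S.Vertex | w ≠ ρ ∧ Sum.inl i ∈ w.1 ∧ Sum.inr j ∈ w.1} =
      {w | w ≠ ρ ∧ Z ⊆ w.1} := by
    ext w
    simp only [Set.mem_ofPred_eq, hsub]
  rw [hset, ← hdZ]
  by_cases hu : Z = Set.univ → S.maxProper.ncard ≠ 2
  · let z : S.Vertex := ⟨Z, Or.inr hZ, hu⟩
    have h1 := hr.finsum_ancestors_sub (rootDist ρ) z
    have h2 : {w : S.Vertex | w ≠ ρ ∧ Z ⊆ w.1} = {w | w ≠ ρ ∧ z ≤ w} := rfl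
    rw [h2, h1]
    have h3 : rootDist ρ ρ = 0 := by simp [rootDist]
    rw [h3, rootDist]
    by_cases hz : z ≤ ρ
    · rw [if_pos hz, if_pos (hz hiZ), if_pos (hz hjZ)]
      ring
    · have hnot : ∀ a ∈ Z, a ∉ ρ.1 := by
        intro a ha haρ
        rcases z.2.1.subset_or_subset ρ.2.1 ha haρ with h | h
        · exact hz h
        · exact hz (hρ.eq_of_le (show ρ ≤ z from h)).ge
      rw [if_neg hz, if_neg (hnot _ hiZ), if_neg (hnot _ hjZ)]
      ring
  · push Not at hu
    have hno : ∀ w : S.Vertex, ¬ Z ⊆ w.1 := fun w hw =>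
      w.2.2 (Set.eq_univ_of_univ_subset (hu.1.symm.subset.trans hw)) hu.2
    have h2 : {w : S.Vertex | w ≠ ρ ∧ Z ⊆ w.1} = ∅ := by
      ext w
      simp [hno w]
    rw [h2, finsum_mem_empty, hu.1, depth_univ (Sum.inl i)]
    by_cases hi : Sum.inl i ∈ ρ.1 <;> by_cases hj : Sum.inr j ∈ ρ.1
    · exact absurd ((hsub ρ).1 ⟨hi, hj⟩) (hno ρ)
    · rw [if_pos hi, if_neg hj]
      ring
    · rw [if_neg hi, if_pos hj]
      ring
    · exfalso
      obtain ⟨m, hm, him⟩ := exists_isMax_mem (S := S) (Sum.inl i)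
      have hne : m ≠ ρ := fun h => hi (h ▸ him)
      refine hno m ((hsub m).1 ⟨him, ?_⟩)
      by_contra hjm
      exact hj (mem_root_of_notMem hρ hm hne hjm)

end Root

end ColorSimilarity

/-! ### Every rank two matrix has a symbic tree; the refinement -/

lemma SymTropRankTwo.exists_mem_openCone {n : ℕ} [NeZero n] {x : SymMat n}
    (hx : SymTropRankTwo x) : ∃ T : SymbicTree n, x ∈ T.openCone := by
  classical
  obtain ⟨S, r, hr⟩ := hx.exists_similarity
  obtain ⟨ρ, hρ, -⟩ := ColorSimilarity.exists_isMax_mem (S := S) (Sum.inl 0)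
  have hpos : ∀ e ∈ S.labeledTree.internalEdges, 0 < S.edgeLength e := by
    intro e he
    obtain ⟨w, hne, hw, rfl⟩ := (ColorSimilarity.mem_internalEdges_iff hρ).1 he
    exact ColorSimilarity.edgeLength_pos hρ hne hw
  have hmat : S.labeledTree.IsMatrixOf S.edgeLength x := by
    let f : Fin n ⊕ Fin n → ℝ := fun a =>
      if a ∈ ρ.1 then - S.depth ρ.1 / 2 else S.depth ρ.1 / 2
    refine ⟨ρ, fun i => r i - f (Sum.inl i), fun j => r j - f (Sum.inr j), fun i j => ?_⟩
    rw [hr, ColorSimilarity.commonLength_labeledTree_eq hρ]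
    simp only [f]
    ring
  have hleaf : ∀ a, S.vertexSwap (S.leafVertex a) = S.leafVertex a.swap := by
    intro a
    refine Subtype.ext ?_
    ext b
    change b.swap = a ↔ b = a.swap
    constructor
    · rintro rfl
      rw [Sum.swap_swap]
    · rintro rfl
      rw [Sum.swap_swap]
  let T : SymbicTree n :=
    { toLabeledTree := S.labeledTree
      bicolored := S.isBicolored_labeledTree
      swap := forestGraphIso S.vertexSwap
      swap_involutive := fun C => Subtype.ext (ColorSimilarity.preimage_swap_swap C.1)
      swap_leaf := hleaf
      fixed_path := LabeledTree.fixed_path_of_symTropRankTwo S.isBicolored_labeledTree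
        (s := forestGraphIso S.vertexSwap) hleaf hmat hpos hx }
  exact ⟨T, S.edgeLength, fun e _ => ColorSimilarity.edgeLength_map_swap e, hpos, hmat⟩

/-- The tree with a single vertex and no labels. -/
lemma SymbicTree.nonempty_zero : Nonempty (SymbicTree 0) := by
  have htree : (⊥ : SimpleGraph Unit).IsTree := SimpleGraph.IsTree.of_subsingleton
  exact ⟨{
    V := Unit
    finite := inferInstance
    graph := ⊥
    isTree := htree
    leaf := fun a => ()
    leaf_injective := fun a => a.elim finZeroElim finZeroElim
    degree_eq_one_iff := fun v => by simp
    degree_ne_two := fun v => by simp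
    bicolored := fun e he => by simp [LabeledTree.internalEdges] at he
    swap := SimpleGraph.Iso.refl
    swap_involutive := fun v => rfl
    swap_leaf := fun a => rfl
    fixed_path := Or.inr ⟨(), (), SimpleGraph.Walk.nil, SimpleGraph.Walk.IsPath.nil, by simp⟩ }⟩

lemma SymTropRankTwo.exists_symbicTree {n : ℕ} {x : SymMat n} (hx : SymTropRankTwo x) :
    ∃ T : SymbicTree n, x ∈ T.openCone := by
  -- Without labels a similarity has no vertices; the one-vertex tree serves instead, the space of
  -- matrices being a point.
  rcases n with - | n
  · obtain ⟨T⟩ := SymbicTree.nonempty_zero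
    obtain ⟨y, hy⟩ := T.openCone_nonempty
    refine ⟨T, ?_⟩
    have : x = y := by
      ext e
      induction e with | _ i j => exact i.elim0
    rwa [this]
  · exact hx.exists_mem_openCone

theorem mainTheorem5 (n : ℕ) :
    ⋃₀ symbicFan n = {x : SymMat n | SymTropRankTwo x} ∧
    FanRefines (symbicFan n) (minorFan n) ∧
    ∀ T T' : SymbicTree n, T.SameType T' → ∀ x ∈ T.openCone, ∀ y ∈ T'.openCone,
      ∀ I J : Fin 3 ↪o Fin n,
        minMonomials (symMinor I J) x = minMonomials (symMinor I J) y := by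
  have h1 : ⋃₀ symbicFan n = {x : SymMat n | SymTropRankTwo x} := by
    ext x
    constructor
    · rintro ⟨_, ⟨T, rfl⟩, hx⟩
      exact SymbicTree.symTropRankTwo_of_mem_cone hx
    · intro hx
      obtain ⟨T, hT⟩ := SymTropRankTwo.exists_symbicTree hx
      exact ⟨_, ⟨T, rfl⟩, SymbicTree.openCone_subset_cone hT⟩
  have h2 : ⋃₀ minorFan n = {x : SymMat n | SymTropRankTwo x} := by
    ext x
    constructor
    · rintro ⟨_, ⟨y, hy, rfl⟩, hx⟩ I J
      exact (hy I J).mono (hx I J)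
    · intro hx
      exact ⟨_, ⟨x, hx, rfl⟩, fun I J => subset_rfl⟩
  refine ⟨h1, ⟨h1.trans h2.symm, ?_, ?_⟩, fun T T' h x hx y hy I J =>
    SymbicTree.SameType.minMonomials_eq h hx hy I J⟩
  · rintro _ ⟨T, rfl⟩
    obtain ⟨x, hx⟩ := T.openCone_nonempty
    exact ⟨_, ⟨x, SymbicTree.symTropRankTwo_of_mem_cone (SymbicTree.openCone_subset_cone hx), rfl⟩,
      SymbicTree.cone_subset_minorCone hx⟩
  · rintro _ ⟨x, hx, rfl⟩
    refine Set.Subset.antisymm (Set.sUnion_subset fun C hC => hC.2) fun y hy => ?_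
    -- Passing from `x` to `y` can only enlarge the minimizing sets, so rank two is inherited.
    have hy2 : SymTropRankTwo y := fun I J => (hx I J).mono (hy I J)
    obtain ⟨T, hT⟩ := hy2.exists_symbicTree
    refine ⟨_, ⟨⟨T, rfl⟩, fun z hz I J => ?_⟩, SymbicTree.openCone_subset_cone hT⟩
    exact (hy I J).trans (SymbicTree.cone_subset_minorCone hT hz I J)
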